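/- Let $E$ be a real vector space. For a family $\mathcal C$ of subsets of $E$ and $x\in E$ put $\mathcal C_x=\{x+\bigcap_{i=1}^r\lambda_iC_i : r\ge 0,\ C_i\in\mathcal C,\ \lambda_i>0\}$. Let $\tau(\mathcal C)$ be the topology whose open sets are the sets that contain, with each of their points $x$, some member of $\mathcal C_x$, and let $\mathcal F(\mathcal C)$ be the $\sigma$-algebra generated by $\bigcup_{x\in E}\mathcal C_x$. We say that $\mathcal C$ satisfies (LCS) if every $C\in\mathcal C$ is a symmetric, algebraically open, convex set containing $0$ such that the topology $\tau(\{C\})$ is separable; $(E,\tau(\mathcal C),\mathcal F(\mathcal C))$ is then called a locally convex separable space. (A set $C$ is algebraically open if for all $x\in C$, $y\in E$ one has $x+ty\in C$ for all sufficiently small $|t|$.) For a vector space $E$ with a topology and a $\sigma$-algebra, let $E^*$ be the space of continuous linear functionals on $E$. For random variables $X_1,X_2,\dots$ in $E$, with $\overline X_n=(X_1+\dots+X_n)/n$, let $$s(x)=\inf_V\liminf_{n\to\infty}\tfrac1n\log\mathbb P(\overline X_n\in V)\quad(x\in E),\qquad p(\lambda)=\limsup_{n\to\infty}\tfrac1n\log\mathbb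 E\big(e^{n\lambda(\overline X_n)}\big)\quad(\lambda\in E^*),$$ where $V$ ranges over the measurable neighbourhoods of $x$, and let $p^*(x)=\sup_{\lambda\in E^*}(\lambda(x)-p(\lambda))$. We say that *Cramér's theorem holds* for $(X_n)$ if $\overline X_n$ (for all $n\geq 1$) and all $\lambda\in E^*$ are measurable, and * (weak large deviation principle) for every measurable $G\subseteq E$, $\liminf_n\frac1n\log\mathbb P(\overline X_n\in G)\ge\sup_{x\in\mathring G}s(x)$, and for every measurable $K\subseteq E$ with compact closure, $\limsup_n\frac1n\log\mathbb P(\overline X_n\in K)\le\sup_{x\in\overline K}s(x)$; * $s=-p^*$ on $E$; * $p(\lambda)=\log\mathbb E\big(e^{\lambda(X_1)}\big)$ for all $\lambda\in E^*$. **Theorem.** 1. If $\mathcal C$ satisfies (LCS), then Cramér's theorem holds for every sequence $(X_n)_{n\ge1}$ of i.i.d. random variables with values in $(E,\tau(\mathcal C),\mathcal F(\mathcal C))$. 2. This covers separable normed spaces (complete or not): if $N$ is one, then $\mathcal C=\{B(0,1)\}$, with $B(0,1)$ the open unit ball, satisfies (LCS), $\tau(\mathcal C)$ is the norm topology and $\mathcal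 F(\mathcal C)$ is the Borel $\sigma$-algebra. 3. This covers weak topologies with the cylinder $\sigma$-algebra: if $\langle\cdot,\cdot\rangle\colon E\times Y\to\mathbb R$ is a bilinear pairing of real vector spaces, then $\mathcal C=\{\{x:|\langle x,y\rangle|<1\}: y\in Y\}$ satisfies (LCS), and $\tau(\mathcal C)$ and $\mathcal F(\mathcal C)$ are the coarsest topology and the smallest $\sigma$-algebra for which all the functionals $\langle\cdot,y\rangle$, $y\in Y$, are continuous, respectively measurable. 4. (Sanov's setting, $\tau$-topology.) Let $(Y_n)_{n\ge1}$ be i.i.d. random variables with values in a measurable space $S$, and let the vector space of finite signed measures on $S$ carry the coarsest topology and the smallest $\sigma$-algebra for which $\nu\mapsto\int f\,d\nu$ is continuous, respectively measurable, for every bounded measurable $f\colon S\to\mathbb R$. Then Cramér's theorem holds for $X_n=\delta_{Y_n}$, i.e. for the empirical measures $\frac1n\sum_{i=1}^n\delta_{Y_i}$. -/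

import Mathlib

open MeasureTheory ProbabilityTheory Filter Topology
open scoped Pointwise

/-! ## The locally convex space generated by a family of sets -/

section LocallyConvexSeparable

variable {E : Type*} [AddCommGroup E] [Module ℝ E]

/-- `C` is algebraically open: its trace on any line through one of its points
contains an open interval around that point. -/
def AlgebraicallyOpen (C : Set E) : Prop :=
  ∀ x ∈ C, ∀ y : E, ∃ ε : ℝ, 0 < ε ∧ ∀ t : ℝ, |t| < ε → x + t • y ∈ C

/-- The family `𝒞_x` of all sets `x + ⋂ i, l i • C i`, the intersection being over `r ≥ 0` indices,
with `C i ∈ 𝒞` and `l i > 0` (for `r = 0` this is the whole space). -/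
def basicNhds (𝒞 : Set (Set E)) (x : E) : Set (Set E) :=
  {V | ∃ (r : ℕ) (C : Fin r → Set E) (l : Fin r → ℝ),
    (∀ i, C i ∈ 𝒞) ∧ (∀ i, 0 < l i) ∧ V = x +ᵥ ⋂ i, l i • C i}

/-- The topology `τ(𝒞)`: a set is open iff with each of its points `x` it contains a
member of `𝒞_x`. -/
@[reducible] def lcTopology (𝒞 : Set (Set E)) : TopologicalSpace E where
  IsOpen U := ∀ x ∈ U, ∃ V ∈ basicNhds 𝒞 x, V ⊆ U
  isOpen_univ := fun x _ =>
    ⟨x +ᵥ ⋂ i : Fin 0, (Fin.elim0 i : ℝ) • (Fin.elim0 i : Set E),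
      ⟨0, fun i => Fin.elim0 i, fun i => Fin.elim0 i, fun i => Fin.elim0 i,
        fun i => Fin.elim0 i, rfl⟩, Set.subset_univ _⟩
  isOpen_inter := by
    rintro U₁ U₂ h₁ h₂ x ⟨hx₁, hx₂⟩
    obtain ⟨_, ⟨r, C, l, hC, hl, rfl⟩, hV⟩ := h₁ x hx₁
    obtain ⟨_, ⟨r', C', l', hC', hl', rfl⟩, hV'⟩ := h₂ x hx₂
    refine ⟨_, ⟨r + r', Fin.append C C', Fin.append l l', ?_, ?_, rfl⟩, ?_⟩
    · intro i
      refine Fin.addCases (fun j => ?_) (fun j => ?_) i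
      · simpa using hC j
      · simpa using hC' j
    · intro i
      refine Fin.addCases (fun j => ?_) (fun j => ?_) i
      · simpa using hl j
      · simpa using hl' j
    · rintro _ ⟨y, hy, rfl⟩
      rw [Set.mem_iInter] at hy
      refine ⟨hV ⟨y, Set.mem_iInter.2 fun i => ?_, rfl⟩, hV' ⟨y, Set.mem_iInter.2 fun i => ?_, rfl⟩⟩
      · simpa using hy (Fin.castAdd r' i)
      · simpa using hy (Fin.natAdd r i)
  isOpen_sUnion := by
    rintro S hS x ⟨U, hU, hx⟩
    obtain ⟨V, hV, hVU⟩ := hS U hU x hx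
    exact ⟨V, hV, hVU.trans (Set.subset_sUnion_of_mem hU)⟩

/-- The σ-algebra `ℱ(𝒞)` generated by all the sets in `⋃ x, 𝒞_x`. -/
@[reducible] def lcSigmaAlgebra (𝒞 : Set (Set E)) : MeasurableSpace E :=
  MeasurableSpace.generateFrom (⋃ x, basicNhds 𝒞 x)

/-- Every `C ∈ 𝒞` is a symmetric algebraically open convex set containing `0` such that the locally
convex topology generated by `C` alone is separable. -/
structure IsLCSFamily (𝒞 : Set (Set E)) : Prop where
  zero_mem : ∀ C ∈ 𝒞, (0 : E) ∈ C
  symmetric : ∀ C ∈ 𝒞, ∀ x ∈ C, -x ∈ C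
  convex : ∀ C ∈ 𝒞, Convex ℝ C
  algebraicallyOpen : ∀ C ∈ 𝒞, AlgebraicallyOpen C
  separable : ∀ C ∈ 𝒞, @TopologicalSpace.SeparableSpace E (lcTopology {C})

end LocallyConvexSeparable

/-! ## Entropy, pressure and weak large deviation principles -/

section LargeDeviations

variable {Ω E : Type*} [MeasurableSpace Ω] [TopologicalSpace E]

/-- The entropy of `(Z n, v n)` under `P`:
`s(x) = inf_V liminf_n (1 / v n) log P(Z n ∈ V)`, over the measurable neighbourhoods `V` of `x`. -/
noncomputable def entropy [MeasurableSpace E] (P : Measure Ω) (Z : ℕ → Ω → E) (v : ℕ → ℝ)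
    (x : E) : EReal :=
  ⨅ V ∈ {V : Set E | V ∈ 𝓝 x ∧ MeasurableSet V},
    liminf (fun n => (((v n)⁻¹ : ℝ) : EReal) * ENNReal.log (P (Z n ⁻¹' V))) atTop

/-- The pressure of `(Z n, v n)` under `P`:
`p(φ) = limsup_n (1 / v n) log E[exp (v n * φ (Z n))]`, for `φ` in the topological dual. -/
noncomputable def pressure [AddCommGroup E] [Module ℝ E] (P : Measure Ω) (Z : ℕ → Ω → E)
    (v : ℕ → ℝ) (φ : E →L[ℝ] ℝ) : EReal :=
  limsup (fun n => (((v n)⁻¹ : ℝ) : EReal) *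
    ENNReal.log (∫⁻ ω, ENNReal.ofReal (Real.exp (v n * φ (Z n ω))) ∂P)) atTop

/-- The Fenchel-Legendre transform `h^*(x) = sup_φ (φ x - h φ)` of a function `h` on the
topological dual. -/
noncomputable def fenchelLegendre [AddCommGroup E] [Module ℝ E] (h : (E →L[ℝ] ℝ) → EReal)
    (x : E) : EReal :=
  ⨆ φ : E →L[ℝ] ℝ, ((φ x : ℝ) : EReal) - h φ

/-- The weak large deviation principle for `(Z n, v n)` with the function `s` (the negative of
the rate function): the lower bound for all measurable sets and the upper bound for all measurable
relatively compact sets. -/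
structure WeakLDP [MeasurableSpace E] (P : Measure Ω) (Z : ℕ → Ω → E) (v : ℕ → ℝ)
    (s : E → EReal) : Prop where
  lower : ∀ G : Set E, MeasurableSet G →
    (⨆ x ∈ interior G, s x) ≤
      liminf (fun n => (((v n)⁻¹ : ℝ) : EReal) * ENNReal.log (P (Z n ⁻¹' G))) atTop
  upper : ∀ K : Set E, MeasurableSet K → IsCompact (closure K) →
    limsup (fun n => (((v n)⁻¹ : ℝ) : EReal) * ENNReal.log (P (Z n ⁻¹' K))) atTop ≤
      ⨆ x ∈ closure K, s x

end LargeDeviations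

/-- The empirical means `(X_1 + ⋯ + X_n) / n`, where `X_1, X_2, …` are written `X 0, X 1, …`
(the value for `n = 0` is `0` and plays no role). -/
noncomputable def empiricalMean {Ω E : Type*} [AddCommGroup E] [Module ℝ E] (X : ℕ → Ω → E)
    (n : ℕ) (ω : Ω) : E :=
  (n : ℝ)⁻¹ • ∑ i ∈ Finset.range n, X i ω

/-- The conclusion of Cramér's theorem for the empirical means `Z_n` of `X 0, X 1, …`, with entropy
`s` and pressure `p` of `(Z_n, n)`: the objects involved are measurable, the weak large
deviation principle holds with the function `s`, one has `s = -p^*`, and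
`p(φ) = log E[exp (φ (X 0))]`. -/
structure CramerConclusion {Ω E : Type*} [MeasurableSpace Ω] [AddCommGroup E] [Module ℝ E]
    [TopologicalSpace E] [MeasurableSpace E] (P : Measure Ω) (X : ℕ → Ω → E) : Prop where
  measurable_mean : ∀ n, Measurable (empiricalMean X n)
  measurable_dual : ∀ φ : E →L[ℝ] ℝ, Measurable φ
  weakLDP : WeakLDP P (empiricalMean X) (fun n => (n : ℝ))
    (entropy P (empiricalMean X) (fun n => (n : ℝ)))
  entropy_eq : ∀ x : E, entropy P (empiricalMean X) (fun n => (n : ℝ)) x =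
    -fenchelLegendre (pressure P (empiricalMean X) (fun n => (n : ℝ))) x
  pressure_eq : ∀ φ : E →L[ℝ] ℝ, pressure P (empiricalMean X) (fun n => (n : ℝ)) φ =
    ENNReal.log (∫⁻ ω, ENNReal.ofReal (Real.exp (φ (X 0 ω))) ∂P)

/-- The bounded measurable real functions on `S`. -/
def BoundedMeasurable (S : Type*) [MeasurableSpace S] : Type _ :=
  {f : S → ℝ // Measurable f ∧ ∃ M : ℝ, ∀ a, |f a| ≤ M}

/-- The `τ`-topology on the finite signed measures on `S`: the weakest topology for which
`ν ↦ ∫ f dν` is continuous for every bounded measurable `f`. -/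
@[reducible] noncomputable def tauTopology (S : Type*) [MeasurableSpace S] :
    TopologicalSpace (SignedMeasure S) :=
  ⨅ f : BoundedMeasurable S, TopologicalSpace.induced (fun ν => ∫ᵛ a, f.1 a ∂•ν) inferInstance

/-- The cylinder σ-algebra on the finite signed measures on `S`: the smallest one for which
`ν ↦ ∫ f dν` is measurable for every bounded measurable `f`. -/
@[reducible] noncomputable def cylinderSigmaAlgebra (S : Type*) [MeasurableSpace S] :
    MeasurableSpace (SignedMeasure S) :=
  ⨆ f : BoundedMeasurable S, MeasurableSpace.comap (fun ν => ∫ᵛ a, f.1 a ∂•ν) (borel ℝ)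

/-! Everything rests on superadditivity. Let μ be the law of one variable and q a continuous
measurable seminorm. If the mean of m variables is r-close to x for q, and that of n further ones
r-close to y, then the mean of all of them is r-close to the barycentre of x and y with weights m
and n; by independence the probabilities multiply. So a ball charged at rate t by a single number m
of variables is charged, after an arbitrarily small loss in radius and rate, by every large number
of them (`Charged.eventually`). Mixing two centres in proportions α and β shows that the set of
pairs (x, a) with a strictly below the rate of a ball about x is convex; the slack in radius and
rate makes it open (`strictHypograph`).

The lower bound of the weak principle is the definition of the entropy. For the upper bound, s(x) <
b yields a ball about x whose probability is at most exp(mb) for every m ≥ 1, and finitely many such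
balls cover a compact set.

In s = -p^*, the inequality ≤ is Chebyshev's. For ≥, Hahn-Banach separates a point (x₀, t₀) from the
open convex hypograph and yields a functional φ with φ(x) + t ≤ φ(x₀) + t₀ for all charged balls of
small radius. It remains to deduce a bound on E[exp φ(X)] without any exponential tightness
(`lintegral_exp_le_of_charged`). For K convex, the n-th power of the integral of exp φ over K is at
most the integral of exp φ for n variables with mean in K; if N balls cover K, this is at most N
exp(n(b + Mr)). Taking n-th roots removes N, separability exhausts E by such K, and then r tends to
0.

In a locally convex separable space each C is the unit ball of a separable measurable seminorm, its
gauge. Separability also makes addition measurable for the product σ-algebra, so that convolutions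
describe sums. -/

/-! ### Convolution powers and their superadditivity -/

section ConvolutionPowers

open scoped ENNReal

variable {E : Type*} [AddCommGroup E] [MeasurableSpace E]

/-- The `n`-th convolution power of `μ`, the law of a sum of `n` independent variables of
law `μ`. -/
noncomputable def convPow (μ : Measure E) : ℕ → Measure E
  | 0 => Measure.dirac 0
  | n + 1 => μ.conv (convPow μ n)

variable [MeasurableAdd₂ E] (μ : Measure E) [IsProbabilityMeasure μ]

instance isProbabilityMeasure_convPow (n : ℕ) : IsProbabilityMeasure (convPow μ n) := by
  induction n with
  | zero => exact Measure.dirac.isProbabilityMeasure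
  | succ n ih => exact Measure.probabilitymeasure_of_probabilitymeasures_conv _ _

theorem convPow_one : convPow μ 1 = μ := by
  simp [convPow]

theorem convPow_add (m n : ℕ) : convPow μ (m + n) = (convPow μ m).conv (convPow μ n) := by
  induction m with
  | zero => simp [convPow]
  | succ m ih => rw [Nat.succ_add, convPow, ih, convPow, Measure.conv_assoc]

theorem lintegral_convPow_add (m n : ℕ) {h : E → ℝ≥0∞} (hh : Measurable h) :
    ∫⁻ z, h z ∂convPow μ (m + n) = ∫⁻ x, ∫⁻ y, h (x + y) ∂convPow μ n ∂convPow μ m := by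
  rw [convPow_add, Measure.lintegral_conv hh]

/-- Superadditivity of the convolution powers, for integrals of functions. -/
theorem lintegral_convPow_mul_le (m n : ℕ) {f g h : E → ℝ≥0∞} (hf : Measurable f)
    (hg : Measurable g) (hh : Measurable h) (H : ∀ x y, f x * g y ≤ h (x + y)) :
    (∫⁻ x, f x ∂convPow μ m) * ∫⁻ y, g y ∂convPow μ n ≤ ∫⁻ z, h z ∂convPow μ (m + n) := by
  rw [lintegral_convPow_add μ m n hh, ← lintegral_mul_const _ hf]
  refine lintegral_mono fun x => ?_
  rw [← lintegral_const_mul _ hg]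
  exact lintegral_mono fun y => H x y

/-- Superadditivity of the convolution powers, for sets. -/
theorem convPow_mul_le (m n : ℕ) {A B C : Set E} (hA : MeasurableSet A)
    (hB : MeasurableSet B) (hC : MeasurableSet C) (H : ∀ x ∈ A, ∀ y ∈ B, x + y ∈ C) :
    convPow μ m A * convPow μ n B ≤ convPow μ (m + n) C := by
  have := lintegral_convPow_mul_le μ m n (f := A.indicator 1) (g := B.indicator 1)
    (h := C.indicator 1) (measurable_one.indicator hA) (measurable_one.indicator hB)
    (measurable_one.indicator hC) (fun x y => by
      by_cases hx : x ∈ A <;> by_cases hy : y ∈ B <;> simp [hx, hy]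
      simp [H x hx y hy])
  simpa [lintegral_indicator_one, hA, hB, hC] using this

theorem lintegral_convPow_exp {φ : E → ℝ} (hφ : Measurable φ) (h0 : φ 0 = 0)
    (hadd : ∀ x y, φ (x + y) = φ x + φ y) (n : ℕ) :
    ∫⁻ y, ENNReal.ofReal (Real.exp (φ y)) ∂convPow μ n =
      (∫⁻ y, ENNReal.ofReal (Real.exp (φ y)) ∂μ) ^ n := by
  have hm : Measurable fun y => ENNReal.ofReal (Real.exp (φ y)) := by fun_prop
  induction n with
  | zero => simp [convPow, lintegral_dirac' _ hm, h0]
  | succ n ih =>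
    rw [convPow, Measure.lintegral_conv hm, pow_succ', ← ih, ← lintegral_mul_const _ hm]
    refine lintegral_congr fun x => ?_
    rw [← lintegral_const_mul _ hm]
    refine lintegral_congr fun y => ?_
    rw [hadd, Real.exp_add, ENNReal.ofReal_mul (Real.exp_pos _).le]

/-- The law of a sum of independent, identically distributed variables is a convolution power. -/
theorem map_sum_eq_convPow {ν : Measure E} {Ω : Type*} [MeasurableSpace Ω] {P : Measure Ω}
    [IsProbabilityMeasure P] {X : ℕ → Ω → E} (hX : ∀ i, Measurable (X i)) (hind : iIndepFun X P)
    (hlaw : ∀ i, P.map (X i) = ν) (n : ℕ) :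
    P.map (∑ i ∈ Finset.range n, X i) = convPow ν n := by
  induction n with
  | zero =>
    simp only [Finset.range_zero, Finset.sum_empty, convPow]
    change P.map (fun _ => (0 : E)) = _
    simp
  | succ n ih =>
    have hS : Measurable (∑ i ∈ Finset.range n, X i) :=
      by simpa only [Finset.sum_fn] using Finset.measurable_fun_sum _ fun i _ => hX i
    rw [Finset.sum_range_succ_comm, IndepFun.map_add_eq_map_conv_map (hX n) hS, ih, hlaw, convPow]
    exact (hind.indepFun_finsetSum_of_notMem hX Finset.notMem_range_self).symm

end ConvolutionPowers

/-! ### Balls charged by empirical means -/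

section MeanBall

open scoped ENNReal

variable {E : Type*} [AddCommGroup E] [Module ℝ E]

/-- The set of sums `y` of `n` vectors whose mean `y / n` is in the open `q`-ball of center `x`
and radius `r`. -/
def meanBall (q : Seminorm ℝ E) (x : E) (r : ℝ) (n : ℕ) : Set E :=
  {y | q (y - (n : ℝ) • x) < n * r}

theorem mem_meanBall {q : Seminorm ℝ E} {x y : E} {r : ℝ} {n : ℕ} :
    y ∈ meanBall q x r n ↔ q (y - (n : ℝ) • x) < n * r := Iff.rfl

theorem mem_meanBall_iff {q : Seminorm ℝ E} {x y : E} {r : ℝ} {n : ℕ} (hn : 1 ≤ n) :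
    y ∈ meanBall q x r n ↔ q ((n : ℝ)⁻¹ • y - x) < r := by
  have hn' : (0 : ℝ) < n := by exact_mod_cast hn
  have : y - (n : ℝ) • x = (n : ℝ) • ((n : ℝ)⁻¹ • y - x) := by
    rw [smul_sub, smul_inv_smul₀ hn'.ne']
  rw [mem_meanBall, this, map_smul_eq_mul, Real.norm_of_nonneg hn'.le, mul_lt_mul_iff_right₀ hn']

theorem meanBall_subset {q : Seminorm ℝ E} {x x' : E} {r r' : ℝ} {n : ℕ}
    (h : q (x - x') + r ≤ r') : meanBall q x r n ⊆ meanBall q x' r' n := by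
  intro y hy
  rw [mem_meanBall] at *
  have h1 : y - (n : ℝ) • x' = (y - (n : ℝ) • x) + (n : ℝ) • (x - x') := by
    rw [smul_sub]; abel
  have h2 : q ((n : ℝ) • (x - x')) = n * q (x - x') := by
    rw [map_smul_eq_mul, Real.norm_of_nonneg (Nat.cast_nonneg n)]
  have h3 := map_add_le_add q (y - (n : ℝ) • x) ((n : ℝ) • (x - x'))
  have h4 : (n : ℝ) * (q (x - x') + r) ≤ n * r' := mul_le_mul_of_nonneg_left h (Nat.cast_nonneg n)
  rw [h1]
  linarith

theorem add_mem_meanBall {q : Seminorm ℝ E} {x y a b z : E} {r : ℝ} {m n : ℕ}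
    (hz : ((m + n : ℕ) : ℝ) • z = (m : ℝ) • x + (n : ℝ) • y)
    (ha : a ∈ meanBall q x r m) (hb : b ∈ meanBall q y r n) :
    a + b ∈ meanBall q z r (m + n) := by
  rw [mem_meanBall] at *
  have h1 : a + b - ((m + n : ℕ) : ℝ) • z = (a - (m : ℝ) • x) + (b - (n : ℝ) • y) := by
    rw [hz]; abel
  have h3 := map_add_le_add q (a - (m : ℝ) • x) (b - (n : ℝ) • y)
  rw [h1]
  push_cast
  linarith

variable [MeasurableSpace E]

/-- Some empirical mean is in the open `q`-ball of center `x` and radius `r` with probability at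
least `exp (m * t)`, `m` being the number of variables. -/
def Charged (μ : Measure E) (q : Seminorm ℝ E) (x : E) (r t : ℝ) : Prop :=
  ∃ m : ℕ, 1 ≤ m ∧ ENNReal.ofReal (Real.exp (m * t)) ≤ convPow μ m (meanBall q x r m)

theorem Charged.mono {μ : Measure E} {q : Seminorm ℝ E} {x x' : E} {r r' t t' : ℝ} (h : Charged μ q x r t)
    (hr : q (x - x') + r ≤ r') (ht : t' ≤ t) : Charged μ q x' r' t' := by
  obtain ⟨m, hm, h⟩ := h
  refine ⟨m, hm, le_trans ?_ (h.trans (measure_mono (meanBall_subset hr)))⟩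
  gcongr

variable [MeasurableAdd₂ E]

theorem measurableSet_meanBall {q : Seminorm ℝ E} (hq : Measurable q) (x : E) (r : ℝ) (n : ℕ) :
    MeasurableSet (meanBall q x r n) := by
  have : Measurable fun y => q (y - (n : ℝ) • x) := by
    simp_rw [sub_eq_add_neg]
    exact hq.comp (measurable_add_const _)
  exact measurableSet_lt this measurable_const

variable (μ : Measure E) [IsProbabilityMeasure μ]

theorem exp_le_convPow_meanBall_add {q : Seminorm ℝ E} (hq : Measurable q) {x y z : E} {r a b : ℝ}
    {m n : ℕ} (hz : ((m + n : ℕ) : ℝ) • z = (m : ℝ) • x + (n : ℝ) • y)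
    (ha : ENNReal.ofReal (Real.exp a) ≤ convPow μ m (meanBall q x r m))
    (hb : ENNReal.ofReal (Real.exp b) ≤ convPow μ n (meanBall q y r n)) :
    ENNReal.ofReal (Real.exp (a + b)) ≤ convPow μ (m + n) (meanBall q z r (m + n)) := by
  rw [Real.exp_add, ENNReal.ofReal_mul (Real.exp_pos _).le]
  exact (mul_le_mul' ha hb).trans (convPow_mul_le μ m n (measurableSet_meanBall hq _ _ _)
    (measurableSet_meanBall hq _ _ _) (measurableSet_meanBall hq _ _ _)
    fun s hs t ht => add_mem_meanBall hz hs ht)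

variable {μ}

theorem Charged.nonpos {q : Seminorm ℝ E} {x : E} {r t : ℝ} (h : Charged μ q x r t) : t ≤ 0 := by
  obtain ⟨m, hm, h⟩ := h
  have h1 := h.trans prob_le_one
  rw [ENNReal.ofReal_le_one, Real.exp_le_one_iff] at h1
  have hm' : (0 : ℝ) < m := by exact_mod_cast hm
  by_contra! ht
  nlinarith [mul_pos hm' ht]

theorem exp_le_convPow_meanBall_mul {q : Seminorm ℝ E} (hq : Measurable q) {x : E} {r t : ℝ}
    {m : ℕ} (h : ENNReal.ofReal (Real.exp (m * t)) ≤ convPow μ m (meanBall q x r m)) {k : ℕ}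
    (hk : 1 ≤ k) :
    ENNReal.ofReal (Real.exp ((k * m : ℕ) * t)) ≤
      convPow μ (k * m) (meanBall q x r (k * m)) := by
  induction k, hk using Nat.le_induction with
  | base => simpa using h
  | succ k hk ih =>
    have := exp_le_convPow_meanBall_add μ hq (z := x) (by push_cast; rw [add_smul]) ih h
    rw [add_one_mul]
    convert this using 3
    push_cast
    ring

/-- The `q`-balls about 0 exhaust the space, and only finitely many laws are involved. This controls
the remainder of a division by `m`. -/
theorem exists_half_le_convPow (q : Seminorm ℝ E) (m : ℕ) :
    ∃ R : ℝ, 0 ≤ R ∧ ∀ j < m, (1 / 2 : ℝ≥0∞) ≤ convPow μ j {y | q y < R} := by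
  have key : ∀ j : ℕ, ∀ᶠ N : ℕ in atTop, (1 / 2 : ℝ≥0∞) ≤ convPow μ j {y | q y < N} := by
    intro j
    have hmono : Monotone fun N : ℕ => {y : E | q y < N} := by
      intro N N' h y hy
      exact lt_of_lt_of_le (show q y < N from hy) (by exact_mod_cast h)
    have hU : (⋃ N : ℕ, {y : E | q y < N}) = Set.univ := by
      ext y
      simpa using exists_nat_gt (q y)
    have ht := tendsto_measure_iUnion_atTop (μ := convPow μ j) hmono
    rw [hU, measure_univ] at ht
    exact (ht.eventually (lt_mem_nhds (by simp : (1 / 2 : ℝ≥0∞) < 1))).mono fun N h => h.le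
  have := (Finset.eventually_all (Finset.range m)).2 fun j _ => key j
  obtain ⟨N, hN⟩ := this.exists
  exact ⟨N, Nat.cast_nonneg N, fun j hj => hN j (Finset.mem_range.2 hj)⟩

/-- If some empirical mean charges a ball then, up to an arbitrarily small loss, all of those with
sufficiently many variables do. -/
theorem Charged.eventually {q : Seminorm ℝ E} (hq : Measurable q) {x : E} {r r' t t' : ℝ}
    (h : Charged μ q x r t) (hr : r < r') (ht : t' < t) :
    ∀ᶠ n : ℕ in atTop, ENNReal.ofReal (Real.exp (n * t')) ≤
      convPow μ n (meanBall q x r' n) := by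
  obtain ⟨m, hm, h⟩ := h
  obtain ⟨R, hR, hRm⟩ := exists_half_le_convPow (μ := μ) q m
  have hm' : (0 : ℝ) < m := by exact_mod_cast hm
  -- A ball of nonpositive radius is empty and cannot be charged. Positivity lets the radius of the
  -- full blocks be enlarged to `n * r`.
  have hr0 : 0 < r := by
    by_contra! hr0
    have : meanBall q x r m = ∅ := by
      ext y
      simp only [mem_meanBall, Set.mem_empty_iff_false, iff_false, not_lt]
      exact (mul_nonpos_of_nonneg_of_nonpos hm'.le hr0).trans (apply_nonneg _ _)
    rw [this, measure_empty, nonpos_iff_eq_zero, ENNReal.ofReal_eq_zero] at h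
    exact absurd (Real.exp_pos _) h.not_gt
  -- Write `n = k * m + j` with `j < m`. The gap in radius pays for the remaining `j` variables; the
  -- gap in rate (`e2`) pays for their probability 1/2 and for the term `j * t`.
  have e1 : ∀ᶠ n : ℕ in atTop, R + m * q x < n * (r' - r) :=
    (tendsto_natCast_atTop_atTop.atTop_mul_const (sub_pos.2 hr)).eventually_gt_atTop _
  have e2 : ∀ᶠ n : ℕ in atTop, m * |t| + Real.log 2 < n * (t - t') :=
    (tendsto_natCast_atTop_atTop.atTop_mul_const (sub_pos.2 ht)).eventually_gt_atTop _
  filter_upwards [e1, e2, eventually_ge_atTop m] with n h1 h2 h3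
  have hk : 1 ≤ n / m := (Nat.one_le_div_iff hm).2 h3
  have hj : n % m < m := Nat.mod_lt _ hm
  have hn : n / m * m + n % m = n := Nat.div_add_mod' n m
  have hnr : (n : ℝ) = ((n / m * m : ℕ) : ℝ) + ((n % m : ℕ) : ℝ) := by exact_mod_cast hn.symm
  have hjr : ((n % m : ℕ) : ℝ) < m := by exact_mod_cast hj
  have hj0 : (0 : ℝ) ≤ ((n % m : ℕ) : ℝ) := Nat.cast_nonneg _
  have hB : MeasurableSet {y : E | q y < R} := measurableSet_lt hq measurable_const
  have step := convPow_mul_le μ (n / m * m) (n % m) (measurableSet_meanBall hq x r (n / m * m)) hB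
    (measurableSet_meanBall hq x r' n) (fun a ha b hb => by
      rw [mem_meanBall] at ha ⊢
      change q b < R at hb
      have d1 : a + b - (n : ℝ) • x =
          (a - ((n / m * m : ℕ) : ℝ) • x) + (b - ((n % m : ℕ) : ℝ) • x) := by
        rw [hnr, add_smul]; abel
      have d2 := map_add_le_add q (a - ((n / m * m : ℕ) : ℝ) • x) (b - ((n % m : ℕ) : ℝ) • x)
      have d3 := map_sub_le_add q b (((n % m : ℕ) : ℝ) • x)
      rw [map_smul_eq_mul, Real.norm_of_nonneg hj0] at d3
      have d4 : ((n % m : ℕ) : ℝ) * q x ≤ m * q x :=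
        mul_le_mul_of_nonneg_right hjr.le (apply_nonneg _ _)
      have d5 : ((n / m * m : ℕ) : ℝ) * r ≤ n * r :=
        mul_le_mul_of_nonneg_right (by linarith) hr0.le
      rw [d1]
      linarith)
  rw [hn] at step
  refine le_trans ?_ ((mul_le_mul' (exp_le_convPow_meanBall_mul hq h hk) (hRm _ hj)).trans step)
  have : (1 / 2 : ℝ≥0∞) = ENNReal.ofReal (Real.exp (-Real.log 2)) := by
    rw [Real.exp_neg, Real.exp_log two_pos, ENNReal.ofReal_inv_of_pos two_pos]
    simp
  rw [this, ← ENNReal.ofReal_mul (Real.exp_pos _).le, ← Real.exp_add]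
  gcongr
  have : ((n / m * m : ℕ) : ℝ) * t = n * t - ((n % m : ℕ) : ℝ) * t := by rw [hnr]; ring
  rw [this]
  have h4 : ((n % m : ℕ) : ℝ) * t ≤ m * |t| :=
    (mul_le_mul_of_nonneg_left (le_abs_self t) hj0).trans
      (mul_le_mul_of_nonneg_right hjr.le (abs_nonneg t))
  linarith

end MeanBall

/-! ### Separable seminorms: measurability and charged balls -/

section SeparableSeminorms

open scoped ENNReal

variable {E : Type*} [AddCommGroup E] [Module ℝ E]

/-- A seminorm which is continuous, measurable, and for which the space is separable. -/
structure SeparableSeminorm [TopologicalSpace E] [MeasurableSpace E] (q : Seminorm ℝ E) :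
    Prop where
  continuous : Continuous q
  measurable : Measurable q
  separable : ∃ D : Set E, D.Countable ∧ ∀ x, ∀ ε > 0, ∃ d ∈ D, q (x - d) < ε

variable [TopologicalSpace E] [MeasurableSpace E] [MeasurableAdd₂ E] {q : Seminorm ℝ E}

/-- Countably many balls, with centers in the dense set and radii 1/(n+1), suffice to write a
`q`-open set as a union. No Borel hypothesis on the σ-algebra is needed. -/
theorem SeparableSeminorm.measurableSet (hq : SeparableSeminorm q) {U : Set E}
    (hU : ∀ x ∈ U, ∃ ε > 0, ∀ y, q (y - x) < ε → y ∈ U) : MeasurableSet U := by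
  obtain ⟨D, hD, hdense⟩ := hq.separable
  have hball : ∀ (d : E) (ε : ℝ), MeasurableSet {y | q (y - d) < ε} := fun d ε => by
    have : Measurable fun y => q (y - d) := by
      simp_rw [sub_eq_add_neg]
      exact hq.measurable.comp (measurable_add_const _)
    exact measurableSet_lt this measurable_const
  have key : U = ⋃ p ∈ {p : E × ℕ | p ∈ D ×ˢ Set.univ ∧
      {y | q (y - p.1) < 1 / ((p.2 : ℝ) + 1)} ⊆ U}, {y | q (y - p.1) < 1 / ((p.2 : ℝ) + 1)} := by
    refine Set.Subset.antisymm (fun x hx => ?_) (Set.iUnion₂_subset fun p hp => hp.2)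
    obtain ⟨ε, hε, h⟩ := hU x hx
    obtain ⟨n, hn⟩ := exists_nat_one_div_lt (half_pos hε)
    obtain ⟨d, hdD, hd⟩ := hdense x (1 / ((n : ℝ) + 1)) Nat.one_div_pos_of_nat
    refine Set.mem_iUnion₂.2 ⟨(d, n), ⟨⟨hdD, trivial⟩, fun y hy => h y ?_⟩, hd⟩
    have h1 := map_sub_le_add q (y - d) (x - d)
    rw [sub_sub_sub_cancel_right] at h1
    have h2 : q (y - d) < 1 / ((n : ℝ) + 1) := hy
    linarith
  rw [key]
  exact MeasurableSet.biUnion ((hD.prod Set.countable_univ).mono fun p hp => hp.1)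
    fun p _ => hball _ _

theorem SeparableSeminorm.measurable_linearMap (hq : SeparableSeminorm q) {φ : E →ₗ[ℝ] ℝ} {M : ℝ}
    (hM : 0 ≤ M) (hφ : ∀ y, φ y ≤ M * q y) : Measurable φ := by
  refine measurable_of_Iio fun a => hq.measurableSet fun x hx => ?_
  have hx' : φ x < a := hx
  refine ⟨(a - φ x) / (M + 1), div_pos (sub_pos.2 hx') (by positivity), fun y hy => ?_⟩
  rw [lt_div_iff₀ (by positivity)] at hy
  have h1 : φ y = φ x + φ (y - x) := by rw [← map_add]; simp
  have h2 := hφ (y - x)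
  change φ y < a
  have := apply_nonneg q (y - x)
  linarith

theorem LinearMap.exists_le_mul_seminorm {E : Type*} [AddCommGroup E] [Module ℝ E]
    (q : Seminorm ℝ E) (φ : E →ₗ[ℝ] ℝ) {ρ C : ℝ} (hρ : 0 < ρ)
    (h : ∀ y, q y < ρ → φ y ≤ C) : ∃ M, 0 ≤ M ∧ ∀ y, φ y ≤ M * q y := by
  have hC : 0 ≤ C := by simpa using h 0 (by simpa using hρ)
  refine ⟨C / ρ, by positivity, fun y => ?_⟩
  -- Taking `s` strictly above `q y / ρ` covers the case `q y = 0`, where rescaling by `q y` itself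
  -- is impossible.
  have key : ∀ s : ℝ, q y / ρ < s → φ y ≤ C * s := by
    intro s hs
    have hs0 : 0 < s := lt_of_le_of_lt (by positivity) hs
    have h1 := h (s⁻¹ • y) (by
      rw [map_smul_eq_mul, Real.norm_of_nonneg (by positivity), inv_mul_lt_iff₀ hs0]
      rwa [div_lt_iff₀ hρ] at hs)
    rw [map_smul, smul_eq_mul, inv_mul_le_iff₀ hs0] at h1
    linarith
  have : Tendsto (fun s : ℝ => C * s) (𝓝[>] (q y / ρ)) (𝓝 (C * (q y / ρ))) :=
    (tendsto_id.const_mul C).mono_left nhdsWithin_le_nhds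
  refine (ge_of_tendsto this ?_).trans_eq (by ring)
  filter_upwards [self_mem_nhdsWithin] with s hs using key s hs

/-- A measure of probability charges a ball of any given radius of a separable seminorm. -/
theorem SeparableSeminorm.exists_charged (hq : SeparableSeminorm q) (μ : Measure E)
    [IsProbabilityMeasure μ] {r : ℝ} (hr : 0 < r) : ∃ x t, Charged μ q x r t := by
  obtain ⟨D, hD, hdense⟩ := hq.separable
  -- Otherwise the space is a countable union of null balls.
  by_contra! hne
  have hzero : ∀ d ∈ D, μ (meanBall q d r 1) = 0 := by
    intro d _
    by_contra h0
    have hlt : μ (meanBall q d r 1) ≠ ⊤ := measure_ne_top _ _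
    have hpos := ENNReal.toReal_pos h0 hlt
    refine hne d (Real.log (μ (meanBall q d r 1)).toReal) ⟨1, le_rfl, ?_⟩
    rw [convPow_one, Nat.cast_one, one_mul, Real.exp_log hpos, ENNReal.ofReal_toReal hlt]
  have huniv : (Set.univ : Set E) ⊆ ⋃ d ∈ D, meanBall q d r 1 := by
    intro x _
    obtain ⟨d, hd, h⟩ := hdense x r hr
    exact Set.mem_iUnion₂.2 ⟨d, hd, by simpa [mem_meanBall] using h⟩
  have := measure_mono_null huniv ((measure_biUnion_null_iff hD).2 hzero)
  rw [measure_univ] at this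
  exact one_ne_zero this

end SeparableSeminorms

/-! ### The strict hypograph is open and convex -/

section Hypograph

open scoped ENNReal

variable {E : Type*} [AddCommGroup E] [Module ℝ E] [MeasurableSpace E]

/-- The points strictly below the function giving the exponential rate of the probability that the
empirical means are in the open `q`-ball of radius `δ` with a given center. -/
def strictHypograph (μ : Measure E) (q : Seminorm ℝ E) (δ : ℝ) : Set (E × ℝ) :=
  {p | ∃ r < δ, ∃ t, p.2 < t ∧ Charged μ q p.1 r t}

variable {μ : Measure E} {q : Seminorm ℝ E} {δ : ℝ}

theorem strictHypograph_translate {p p' : E × ℝ} {r t : ℝ} (h : Charged μ q p.1 r t)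
    (hr : r + q (p'.1 - p.1) < δ) (ht : p'.2 < t) : p' ∈ strictHypograph μ q δ :=
  ⟨_, hr, t, ht, h.mono (by rw [map_sub_rev, add_comm]) le_rfl⟩

theorem isOpen_strictHypograph [TopologicalSpace E] [IsTopologicalAddGroup E]
    (hq : Continuous q) : IsOpen (strictHypograph μ q δ) := by
  rw [isOpen_iff_mem_nhds]
  rintro p ⟨r, hr, t, ht, h⟩
  have h1 : ∀ᶠ p' : E × ℝ in 𝓝 p, r + q (p'.1 - p.1) < δ := by
    have : ContinuousAt (fun p' : E × ℝ => r + q (p'.1 - p.1)) p := by fun_prop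
    exact this.eventually (gt_mem_nhds (by simpa using hr))
  have h2 : ∀ᶠ p' : E × ℝ in 𝓝 p, p'.2 < t :=
    continuous_snd.continuousAt.eventually (gt_mem_nhds ht)
  filter_upwards [h1, h2] with p' h1 h2 using strictHypograph_translate h h1 h2

theorem convex_strictHypograph [MeasurableAdd₂ E] [IsProbabilityMeasure μ] (hq : Measurable q) :
    Convex ℝ (strictHypograph μ q δ) := by
  rw [convex_iff_forall_pos]
  rintro ⟨x, a⟩ ⟨r₁, hr₁, a', ha', hx⟩ ⟨y, b⟩ ⟨r₂, hr₂, b', hb', hy⟩ α β hα hβ hαβ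
  obtain ⟨r, hr, hrδ⟩ := exists_between (max_lt hr₁ hr₂)
  obtain ⟨a'', ha, ha''⟩ := exists_between ha'
  obtain ⟨b'', hb, hb''⟩ := exists_between hb'
  have ex := hx.eventually hq ((le_max_left _ _).trans_lt hr) ha''
  have ey := hy.eventually hq ((le_max_right _ _).trans_lt hr) hb''
  -- Of `n` variables, `i n` are used near `x` and the other `n - i n` near `y`; both numbers tend
  -- to infinity.
  set i : ℕ → ℕ := fun n => ⌊α * (n : ℝ)⌋₊ with hi
  have hle : ∀ n, i n + ⌊β * (n : ℝ)⌋₊ ≤ n := by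
    intro n
    have h1 : ((⌊α * (n : ℝ)⌋₊ : ℕ) : ℝ) ≤ α * n := Nat.floor_le (by positivity)
    have h2 : ((⌊β * (n : ℝ)⌋₊ : ℕ) : ℝ) ≤ β * n := Nat.floor_le (by positivity)
    have h3 : α * (n : ℝ) + β * n = n := by rw [← add_mul, hαβ, one_mul]
    have : ((i n + ⌊β * (n : ℝ)⌋₊ : ℕ) : ℝ) ≤ n := by push_cast; linarith
    exact_mod_cast this
  have ti : Tendsto i atTop atTop := tendsto_nat_floor_atTop.comp
    (tendsto_natCast_atTop_atTop.const_mul_atTop hα)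
  have tj : Tendsto (fun n => n - i n) atTop atTop := tendsto_atTop_mono
    (fun n => Nat.le_sub_of_add_le' (hle n))
    (tendsto_nat_floor_atTop.comp (tendsto_natCast_atTop_atTop.const_mul_atTop hβ))
  have tα : Tendsto (fun n : ℕ => (i n : ℝ) / n - α) atTop (𝓝 0) := by
    simpa using ((tendsto_nat_floor_mul_div_atTop hα.le).comp
      tendsto_natCast_atTop_atTop).sub_const α
  have e1 : ∀ᶠ n : ℕ in atTop, |(i n : ℝ) / n - α| * q (x - y) < δ - r := by
    have := (tα.abs.mul_const (q (x - y)))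
    rw [abs_zero, zero_mul] at this
    exact this.eventually (gt_mem_nhds (sub_pos.2 hrδ))
  have e2 : ∀ᶠ n : ℕ in atTop, α * a + β * b <
      α * a'' + β * b'' + ((i n : ℝ) / n - α) * (a'' - b'') := by
    have := (tα.mul_const (a'' - b'')).const_add (α * a'' + β * b'')
    rw [zero_mul, add_zero] at this
    exact this.eventually (lt_mem_nhds (by gcongr))
  obtain ⟨n, hxn, hyn, h1, h2, hn⟩ := ((ti.eventually ex).and ((tj.eventually ey).and
    (e1.and (e2.and (eventually_ge_atTop 1))))).exists
  have hin : i n ≤ n := (Nat.le_add_right _ _).trans (hle n)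
  have hn0 : (n : ℝ) ≠ 0 := by positivity
  have hj : ((n - i n : ℕ) : ℝ) = n - i n := Nat.cast_sub hin
  set ε := (i n : ℝ) / n - α with hε
  have hiε : (i n : ℝ) = n * (α + ε) := by rw [hε]; field_simp; ring
  have hβ' : β = 1 - α := by linarith
  -- The actual weights are `α + ε` and `β - ε`. The barycentre is off by `|ε| * q (x - y)`, which
  -- `h1` fits into `δ - r`; `h2` does the same for the rate.
  have hz : ((i n + (n - i n) : ℕ) : ℝ) • ((α + ε) • x + (β - ε) • y) =
      (i n : ℝ) • x + ((n - i n : ℕ) : ℝ) • y := by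
    rw [Nat.add_sub_cancel' hin, smul_add, smul_smul, smul_smul, hj, hiε, hβ']
    congr 2
    ring
  have key := exp_le_convPow_meanBall_add μ hq hz hxn hyn
  rw [Nat.add_sub_cancel' hin] at key
  refine ⟨r + |ε| * q (x - y), by linarith, _, h2, Charged.mono
    (x := (α + ε) • x + (β - ε) • y) (r := r) ⟨n, hn, le_trans (le_of_eq ?_) key⟩ ?_ le_rfl⟩
  · congr 2
    rw [hj, hiε, hβ']
    ring
  · have : (α + ε) • x + (β - ε) • y - (α • (x, a) + β • (y, b)).1 = ε • (x - y) := by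
      simp only [Prod.fst_add, Prod.smul_fst, add_smul, sub_smul, smul_sub]
      abel
    rw [this, map_smul_eq_mul, Real.norm_eq_abs, add_comm]

end Hypograph

/-! ### From exponential rates to Laplace transforms, and Hahn-Banach separation -/

section Duality

open scoped ENNReal

/-- A constant factor disappears on taking `n`-th roots. It will be the number of balls in a cover.
-/
theorem ENNReal.le_of_forall_pow_le_mul_pow {a : ℝ≥0∞} {b : ℝ} (N : ℕ)
    (h : ∀ n : ℕ, 1 ≤ n → a ^ n ≤ N * ENNReal.ofReal (Real.exp (n * b))) :
    a ≤ ENNReal.ofReal (Real.exp b) := by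
  by_contra! hlt
  obtain ⟨c, hbc, hca⟩ := ENNReal.lt_iff_exists_nnreal_btwn.1 hlt
  rw [← ENNReal.ofReal_coe_nnreal, ENNReal.ofReal_lt_ofReal_iff_of_nonneg (Real.exp_pos _).le] at hbc
  -- The summand 1 excludes `n = 0`.
  obtain ⟨n, hn⟩ := pow_unbounded_of_one_lt ((N : ℝ) + 1) ((one_lt_div (Real.exp_pos b)).2 hbc)
  have hn1 : 1 ≤ n := by
    rcases Nat.eq_zero_or_pos n with rfl | h0
    · simp at hn
      linarith [Nat.cast_nonneg (α := ℝ) N]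
    · exact h0
  have h1 := (pow_le_pow_left' hca.le n).trans (h n hn1)
  rw [← ENNReal.ofReal_coe_nnreal, ← ENNReal.ofReal_pow c.coe_nonneg, ← ENNReal.ofReal_natCast,
    ← ENNReal.ofReal_mul (Nat.cast_nonneg N), ENNReal.ofReal_le_ofReal_iff (by positivity),
    Real.exp_nat_mul] at h1
  rw [div_pow, lt_div_iff₀ (by positivity)] at hn
  have : (0 : ℝ) < Real.exp b ^ n := by positivity
  linarith

variable {E : Type*} [AddCommGroup E] [Module ℝ E] [MeasurableSpace E] [MeasurableAdd₂ E]
  [MeasurableConstSMul ℝ E]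
  {μ : Measure E} [IsProbabilityMeasure μ] {q : Seminorm ℝ E}

/-- Superadditivity of the Laplace transforms restricted to a convex set. -/
theorem setLIntegral_exp_pow_le {φ : E →ₗ[ℝ] ℝ} (hφ : Measurable φ) {K : Set E}
    (hK : Convex ℝ K) (hKm : MeasurableSet K) {n : ℕ} (hn : 1 ≤ n) :
    (∫⁻ y in K, ENNReal.ofReal (Real.exp (φ y)) ∂μ) ^ n ≤
      ∫⁻ y in {y | (n : ℝ)⁻¹ • y ∈ K}, ENNReal.ofReal (Real.exp (φ y)) ∂convPow μ n := by
  have hm : Measurable fun y => ENNReal.ofReal (Real.exp (φ y)) := by fun_prop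
  have hKn : ∀ n : ℕ, MeasurableSet {y | (n : ℝ)⁻¹ • y ∈ K} := fun n =>
    measurable_const_smul (n : ℝ)⁻¹ hKm
  induction n, hn using Nat.le_induction with
  | base => simp [convPow_one]
  | succ n hn ih =>
    rw [pow_succ', add_comm n 1]
    refine (mul_le_mul' le_rfl ih).trans ?_
    rw [← lintegral_indicator hKm, ← lintegral_indicator (hKn n), ← lintegral_indicator (hKn _)]
    have := lintegral_convPow_mul_le μ 1 n (hm.indicator hKm) (hm.indicator (hKn n))
      (hm.indicator (hKn _)) fun x y => by
      by_cases hx : x ∈ K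
      · by_cases hy : (n : ℝ)⁻¹ • y ∈ K
        · have hn0 : (n : ℝ) ≠ 0 := by positivity
          -- The new mean is a convex combination of `x`, with weight 1/(n+1), and of the mean `y /
          -- n`.
          have hxy : ((1 + n : ℕ) : ℝ)⁻¹ • (x + y) ∈ K := by
            have := hK hx hy (a := ((1 + n : ℕ) : ℝ)⁻¹) (b := ((1 + n : ℕ) : ℝ)⁻¹ * n)
              (by positivity) (by positivity) (by push_cast; field_simp)
            rwa [smul_smul, mul_assoc, mul_inv_cancel₀ hn0, mul_one, ← smul_add] at this
          rw [Set.indicator_of_mem hx, Set.indicator_of_mem (by exact hy),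
            Set.indicator_of_mem (by exact hxy), map_add, Real.exp_add,
            ENNReal.ofReal_mul (Real.exp_pos _).le]
        · rw [Set.indicator_of_notMem (s := {y | (n : ℝ)⁻¹ • y ∈ K}) (by exact hy), mul_zero]
          exact zero_le
      · rw [Set.indicator_of_notMem hx, zero_mul]
        exact zero_le
    rwa [convPow_one] at this

/-- A bound on the exponential rates on the balls of radius `r` yields a bound on the Laplace
transform restricted to a convex set covered by finitely many such balls. -/
theorem setLIntegral_exp_le_of_cover {φ : E →ₗ[ℝ] ℝ} (hφ : Measurable φ)
    {M : ℝ} (hM : 0 ≤ M) (hφM : ∀ y, φ y ≤ M * q y) {r b : ℝ}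
    (h : ∀ x t, Charged μ q x r t → φ x + t ≤ b) {K : Set E} (hK : Convex ℝ K)
    (hKm : MeasurableSet K) (s : Finset E) (hs : ∀ y ∈ K, ∃ c ∈ s, q (y - c) < r) :
    ∫⁻ y in K, ENNReal.ofReal (Real.exp (φ y)) ∂μ ≤
      ENNReal.ofReal (Real.exp (b + M * r)) := by
  refine ENNReal.le_of_forall_pow_le_mul_pow s.card fun n hn => ?_
  refine (setLIntegral_exp_pow_le hφ hK hKm hn).trans ?_
  have hn0 : (0 : ℝ) < n := by positivity
  have hsub : {y | (n : ℝ)⁻¹ • y ∈ K} ⊆ ⋃ c : s, meanBall q (c : E) r n := by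
    intro y hy
    obtain ⟨c, hc, hyc⟩ := hs _ hy
    exact Set.mem_iUnion.2 ⟨⟨c, hc⟩, (mem_meanBall_iff hn).2 hyc⟩
  refine (lintegral_mono_set hsub).trans ((lintegral_iUnion_le _ _).trans ?_)
  rw [tsum_fintype]
  refine (Finset.sum_le_card_nsmul _ _ (ENNReal.ofReal (Real.exp (n * (b + M * r))))
    fun c _ => ?_).trans (by simp)
  have h1 : ∀ y ∈ meanBall q (c : E) r n, ENNReal.ofReal (Real.exp (φ y)) ≤
      ENNReal.ofReal (Real.exp (n * φ c + n * (M * r))) := by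
    intro y hy
    gcongr
    have h2 : φ y = φ ((n : ℝ) • (c : E)) + φ (y - (n : ℝ) • (c : E)) := by
      rw [← map_add]; simp
    have h3 := hφM (y - (n : ℝ) • (c : E))
    have h4 := mul_le_mul_of_nonneg_left (mem_meanBall.1 hy).le hM
    rw [map_smul, smul_eq_mul] at h2
    linarith
  refine (setLIntegral_mono measurable_const h1).trans ?_
  rw [setLIntegral_const]
  have hlt : convPow μ n (meanBall q (c : E) r n) ≠ ⊤ := measure_ne_top _ _
  by_cases h0 : convPow μ n (meanBall q (c : E) r n) = 0
  · rw [h0, mul_zero]; exact zero_le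
  · have hpos := ENNReal.toReal_pos h0 hlt
    set w := (convPow μ n (meanBall q (c : E) r n)).toReal with hw
    -- The ball has probability `w`, so it is charged at the exact rate `log w / n`, and `h` applies
    -- to that rate.
    have hwt : Real.exp (n * (Real.log w / n)) = w := by
      rw [mul_div_cancel₀ _ hn0.ne', Real.exp_log hpos]
    have hcw : convPow μ n (meanBall q (c : E) r n) =
        ENNReal.ofReal (Real.exp (n * (Real.log w / n))) := by
      rw [hwt, hw, ENNReal.ofReal_toReal hlt]
    have h5 := h c (Real.log w / n) ⟨n, hn, hcw.ge⟩
    rw [hcw, ← ENNReal.ofReal_mul (Real.exp_pos _).le, ← Real.exp_add]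
    gcongr
    have h6 := mul_le_mul_of_nonneg_left h5 hn0.le
    linarith

variable [TopologicalSpace E] [IsTopologicalAddGroup E] [ContinuousSMul ℝ E]

theorem lintegral_exp_le_of_charged_radius (hq : SeparableSeminorm q) {φ : E →ₗ[ℝ] ℝ}
    {M : ℝ} (hM : 0 ≤ M) (hφM : ∀ y, φ y ≤ M * q y) {r b : ℝ} (hr : 0 < r)
    (h : ∀ x t, Charged μ q x r t → φ x + t ≤ b) :
    ∫⁻ y, ENNReal.ofReal (Real.exp (φ y)) ∂μ ≤ ENNReal.ofReal (Real.exp (b + M * r)) := by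
  have hφ : Measurable φ := hq.measurable_linearMap hM hφM
  obtain ⟨D, hD, hdense⟩ := hq.separable
  have hDne : D.Nonempty := by
    obtain ⟨d, hd, -⟩ := hdense 0 1 one_pos
    exact ⟨d, hd⟩
  obtain ⟨d, rfl⟩ := hD.exists_eq_range hDne
  -- The hulls are compact, hence have finite covers by balls of radius `r / 2`. Thickening them
  -- keeps convexity, makes them `q`-open and so measurable, and lets them exhaust the space; balls
  -- of radius `r` then cover `K k`.
  set K : ℕ → Set E := fun k => {y | ∃ z ∈ convexHull ℝ (d '' Set.Iic k), q (y - z) < r / 2}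
    with hKdef
  have hconv : ∀ k, Convex ℝ (K k) := by
    rintro k y ⟨z, hz, hyz⟩ y' ⟨z', hz', hyz'⟩ α β hα hβ hαβ
    refine ⟨α • z + β • z', convex_convexHull ℝ _ hz hz' hα hβ hαβ, ?_⟩
    have h1 : α • y + β • y' - (α • z + β • z') = α • (y - z) + β • (y' - z') := by
      simp only [smul_sub]; abel
    have := (q.convexOn.convex_lt (r / 2)) (x := y - z) ⟨trivial, hyz⟩ (y := y' - z')
      ⟨trivial, hyz'⟩ hα hβ hαβ
    rw [h1]
    exact this.2
  have hmeas : ∀ k, MeasurableSet (K k) := by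
    refine fun k => hq.measurableSet ?_
    rintro x ⟨z, hz, hxz⟩
    refine ⟨r / 2 - q (x - z), sub_pos.2 hxz, fun y hy => ⟨z, hz, ?_⟩⟩
    have := map_add_le_add q (y - x) (x - z)
    rw [sub_add_sub_cancel] at this
    linarith
  have hmono : Monotone K := by
    rintro k l hkl y ⟨z, hz, hyz⟩
    exact ⟨z, convexHull_mono (Set.image_mono (Set.Iic_subset_Iic.2 hkl)) hz, hyz⟩
  have hcover : ⋃ k, K k = Set.univ := by
    refine Set.eq_univ_of_forall fun x => ?_
    obtain ⟨_, ⟨k, rfl⟩, hk⟩ := hdense x (r / 2) (half_pos hr)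
    exact Set.mem_iUnion.2 ⟨k, d k, subset_convexHull ℝ _ ⟨k, Set.self_mem_Iic, rfl⟩, hk⟩
  rw [← setLIntegral_univ, ← hcover, setLIntegral_iUnion_of_directed _ hmono.directed_le]
  refine iSup_le fun k => ?_
  have hcomp : IsCompact (convexHull ℝ (d '' Set.Iic k)) :=
    ((Set.finite_Iic k).image d).isCompact_convexHull ℝ
  obtain ⟨s, -, hs⟩ := hcomp.elim_nhds_subcover (fun c => {y | q (y - c) < r / 2}) fun c _ => by
    have : ContinuousAt (fun y => q (y - c)) c :=
      (hq.continuous.comp (continuous_id.sub continuous_const)).continuousAt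
    exact this.eventually (gt_mem_nhds (by simpa using half_pos hr))
  refine setLIntegral_exp_le_of_cover hφ hM hφM h (hconv k) (hmeas k) s ?_
  rintro y ⟨z, hz, hyz⟩
  obtain ⟨c, hc, hzc⟩ := Set.mem_iUnion₂.1 (hs hz)
  refine ⟨c, hc, ?_⟩
  have h1 := map_add_le_add q (y - z) (z - c)
  rw [sub_add_sub_cancel] at h1
  have h2 : q (z - c) < r / 2 := hzc
  linarith

/-- The upper bound half of the duality between the entropy and the pressure: a bound on the
exponential rates bounds the Laplace transform. -/
theorem lintegral_exp_le_of_charged (hq : SeparableSeminorm q) {φ : E →ₗ[ℝ] ℝ}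
    {M : ℝ} (hM : 0 ≤ M) (hφM : ∀ y, φ y ≤ M * q y) {δ b : ℝ} (hδ : 0 < δ)
    (h : ∀ r < δ, ∀ x t, Charged μ q x r t → φ x + t ≤ b) :
    ∫⁻ y, ENNReal.ofReal (Real.exp (φ y)) ∂μ ≤ ENNReal.ofReal (Real.exp b) := by
  have hcont : Continuous fun r : ℝ => ENNReal.ofReal (Real.exp (b + M * r)) :=
    ENNReal.continuous_ofReal.comp (by fun_prop)
  have ht : Tendsto (fun r : ℝ => ENNReal.ofReal (Real.exp (b + M * r))) (𝓝[>] 0)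
      (𝓝 (ENNReal.ofReal (Real.exp b))) := by
    simpa using (hcont.tendsto 0).mono_left nhdsWithin_le_nhds
  refine ge_of_tendsto ht ?_
  filter_upwards [Ioo_mem_nhdsGT hδ] with r hr
  exact lintegral_exp_le_of_charged_radius hq hM hφM hr.1 (h r hr.2)

/-- A point which is not below the exponential rates of the probabilities of balls is separated from
those by a continuous linear functional. -/
theorem exists_dual_of_notMem_strictHypograph (hq : SeparableSeminorm q) {δ : ℝ} (hδ : 0 < δ)
    {x₀ : E} {t₀ : ℝ} (h₀ : (x₀, t₀) ∉ strictHypograph μ q δ) :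
    ∃ φ : E →L[ℝ] ℝ, ∫⁻ y, ENNReal.ofReal (Real.exp (φ y)) ∂μ ≤
      ENNReal.ofReal (Real.exp (φ x₀ + t₀)) := by
  obtain ⟨f, hf⟩ := geometric_hahn_banach_open_point (convex_strictHypograph hq.measurable)
    (isOpen_strictHypograph hq.continuous) h₀
  set g : E →L[ℝ] ℝ := f.comp (ContinuousLinearMap.inl ℝ E ℝ) with hg
  set c : ℝ := f (0, 1) with hc
  have hfs : ∀ x t, f (x, t) = g x + c * t := by
    intro x t
    have : (x, t) = (x, 0) + t • ((0 : E), (1 : ℝ)) := by simp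
    rw [this, map_add, map_smul, smul_eq_mul, mul_comm t]
    rfl
  have hsep : ∀ x t, (x, t) ∈ strictHypograph μ q δ → g x + c * t < g x₀ + c * t₀ := by
    intro x t h
    rw [← hfs, ← hfs]
    exact hf _ h
  obtain ⟨x₁, t₁, h₁⟩ := hq.exists_charged μ (half_pos hδ)
  have hδ2 : δ / 2 < δ := half_lt_self hδ
  -- The hypograph contains the half-line below each of its points; a negative `c` would make `f`
  -- unbounded above there.
  have hc0 : 0 ≤ c := by
    by_contra! hneg
    obtain ⟨s, hs1, h2⟩ : ∃ s, 1 ≤ s ∧ (g x₀ + c * t₀ - g x₁ - c * t₁) / -c ≤ s :=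
      ⟨_, le_max_left _ _, le_max_right _ _⟩
    have h1 := hsep x₁ (t₁ - s) ⟨_, hδ2, t₁, by change t₁ - s < t₁; linarith, h₁⟩
    rw [div_le_iff₀ (neg_pos.2 hneg)] at h2
    linarith
  -- The hypograph contains a `q`-ball around `x₁` at height `t₁ - 1`, on which `g` is bounded
  -- above.
  obtain ⟨M, hM, hgM⟩ := LinearMap.exists_le_mul_seminorm q (g : E →ₗ[ℝ] ℝ) (half_pos hδ)
    (C := g x₀ + c * t₀ - g x₁ - c * (t₁ - 1)) fun y hy => by
      have := hsep (x₁ + y) (t₁ - 1) (strictHypograph_translate (p := (x₁, t₁)) h₁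
        (by simpa using by linarith) (by simp))
      rw [map_add] at this
      simp only [ContinuousLinearMap.coe_coe]
      linarith
  simp only [ContinuousLinearMap.coe_coe] at hgM
  -- If the hyperplane is vertical, `g` stays below `g x₀` by a fixed margin `g y` on the centers of
  -- charged balls of radius below `δ / 2`. As rates are nonpositive, a large multiple `k • g` makes
  -- up for `t₀`.
  rcases hc0.eq_or_lt with hc0 | hc0
  · simp only [← hc0, zero_mul, add_zero] at hsep
    have hη : ∃ y, q y < δ / 2 ∧ 0 < g y := by
      have h1 := hsep x₁ (t₁ - 1) ⟨_, hδ2, t₁, by linarith, h₁⟩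
      have hq0 : 0 ≤ q (x₀ - x₁) := apply_nonneg _ _
      refine ⟨(δ / 2 / (q (x₀ - x₁) + 1)) • (x₀ - x₁), ?_, ?_⟩
      · rw [map_smul_eq_mul, Real.norm_of_nonneg (by positivity), div_mul_eq_mul_div,
          div_lt_iff₀ (by positivity)]
        gcongr
        linarith
      · rw [map_smul, smul_eq_mul]
        exact mul_pos (by positivity) (by rw [map_sub]; linarith)
    obtain ⟨y, hqy, hgy⟩ := hη
    obtain ⟨k, hk⟩ := exists_nat_ge (-t₀ / g y)
    rw [div_le_iff₀ hgy] at hk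
    refine ⟨(k : ℝ) • g, lintegral_exp_le_of_charged hq (φ := ((k : ℝ) • g : E →L[ℝ] ℝ))
      (M := k * M) (by positivity) (fun z => ?_) (half_pos hδ) fun r hr x t hx => ?_⟩
    · have := mul_le_mul_of_nonneg_left (hgM z) (Nat.cast_nonneg (α := ℝ) k)
      simpa [mul_assoc] using this
    · have h1 := hsep (x + y) (t - 1) (strictHypograph_translate (p := (x, t)) hx
        (by simpa using by linarith) (by simp))
      rw [map_add] at h1
      have h2 := mul_le_mul_of_nonneg_left h1.le (Nat.cast_nonneg (α := ℝ) k)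
      have h3 := hx.nonpos
      simp only [ContinuousLinearMap.coe_coe, _root_.smul_apply, smul_eq_mul]
      linarith
  -- Otherwise the slope is normalised to 1.
  · refine ⟨c⁻¹ • g, lintegral_exp_le_of_charged hq (φ := (c⁻¹ • g : E →L[ℝ] ℝ))
      (M := c⁻¹ * M) (by positivity) (fun z => ?_) hδ fun r hr x t hx => ?_⟩
    · have := mul_le_mul_of_nonneg_left (hgM z) (inv_pos.2 hc0).le
      simpa [mul_assoc] using this
    · have h1 : t ≤ c⁻¹ * (g x₀ + c * t₀ - g x) := by
        refine le_of_forall_lt fun s hs => ?_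
        have := hsep x s ⟨r, hr, t, hs, hx⟩
        rw [lt_inv_mul_iff₀ hc0]
        linarith
      have h2 : c⁻¹ * (g x₀ + c * t₀ - g x) = c⁻¹ * g x₀ + t₀ - c⁻¹ * g x := by
        field_simp
      simp only [ContinuousLinearMap.coe_coe, _root_.smul_apply, smul_eq_mul]
      linarith

end Duality

/-! ### Rates in the extended reals -/

section ExponentialRates

open scoped ENNReal

/-- Infinite values of the logarithm are thus avoided. The equivalence fails for `n = 0`, where the
factor is 0. -/
theorem EReal.le_inv_mul_log_iff {a : ℝ} {w : ℝ≥0∞} {n : ℕ} (hn : 1 ≤ n) :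
    (a : EReal) ≤ (((n : ℝ)⁻¹ : ℝ) : EReal) * ENNReal.log w ↔
      ENNReal.ofReal (Real.exp (n * a)) ≤ w := by
  have hn' : (0 : ℝ) < n := by exact_mod_cast hn
  have ha : (a : EReal) = ENNReal.log (ENNReal.ofReal (Real.exp a)) := by
    rw [ENNReal.log_ofReal_of_pos (Real.exp_pos a), Real.log_exp]
  rw [← ENNReal.log_rpow, ha, ENNReal.log_le_log_iff, ENNReal.le_rpow_inv_iff hn',
    ENNReal.ofReal_rpow_of_pos (Real.exp_pos a), ← Real.exp_mul, mul_comm a]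

theorem EReal.inv_mul_log_le_iff {a : ℝ} {w : ℝ≥0∞} {n : ℕ} (hn : 1 ≤ n) :
    (((n : ℝ)⁻¹ : ℝ) : EReal) * ENNReal.log w ≤ a ↔
      w ≤ ENNReal.ofReal (Real.exp (n * a)) := by
  have hn' : (0 : ℝ) < n := by exact_mod_cast hn
  have ha : (a : EReal) = ENNReal.log (ENNReal.ofReal (Real.exp a)) := by
    rw [ENNReal.log_ofReal_of_pos (Real.exp_pos a), Real.log_exp]
  rw [← ENNReal.log_rpow, ha, ENNReal.log_le_log_iff, ENNReal.rpow_inv_le_iff hn',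
    ENNReal.ofReal_rpow_of_pos (Real.exp_pos a), ← Real.exp_mul, mul_comm a]

end ExponentialRates

/-! ### Laws of empirical means -/

section EmpiricalMeans

variable {E Ω : Type*} [AddCommGroup E] [Module ℝ E] [MeasurableSpace E] [MeasurableAdd₂ E]
  [MeasurableConstSMul ℝ E] [MeasurableSpace Ω] {X : ℕ → Ω → E}

theorem measurable_empiricalMean (hX : ∀ i, Measurable (X i)) (n : ℕ) :
    Measurable (empiricalMean X n) :=
  (Finset.measurable_fun_sum _ fun i _ => hX i).const_smul _

variable {P : Measure Ω} [IsProbabilityMeasure P]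

theorem measure_empiricalMean_preimage (hX : ∀ i, Measurable (X i)) (hind : iIndepFun X P)
    (hid : ∀ i, IdentDistrib (X i) (X 0) P P) (n : ℕ) {V : Set E} (hV : MeasurableSet V) :
    P (empiricalMean X n ⁻¹' V) = convPow (P.map (X 0)) n {y | (n : ℝ)⁻¹ • y ∈ V} := by
  have hS : Measurable (∑ i ∈ Finset.range n, X i) := by
    simpa only [Finset.sum_fn] using Finset.measurable_fun_sum _ fun i _ => hX i
  rw [← map_sum_eq_convPow hX hind (fun i => (hid i).map_eq) n,
    Measure.map_apply hS (show MeasurableSet {y | (n : ℝ)⁻¹ • y ∈ V} from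
      measurable_const_smul (n : ℝ)⁻¹ hV)]
  congr 1
  ext ω
  simp [empiricalMean]

theorem measure_empiricalMean_preimage_ball {q : Seminorm ℝ E} (hq : Measurable q)
    (hX : ∀ i, Measurable (X i)) (hind : iIndepFun X P)
    (hid : ∀ i, IdentDistrib (X i) (X 0) P P) {n : ℕ} (hn : 1 ≤ n) (x : E) (r : ℝ) :
    P (empiricalMean X n ⁻¹' {y | q (y - x) < r}) =
      convPow (P.map (X 0)) n (meanBall q x r n) := by
  have hV : MeasurableSet {y | q (y - x) < r} := by
    have := measurableSet_meanBall hq x r 1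
    simpa [meanBall] using this
  rw [measure_empiricalMean_preimage hX hind hid n hV]
  congr 1
  ext y
  exact (mem_meanBall_iff hn).symm

end EmpiricalMeans

/-! ### Cramér's theorem for spaces with separable seminorms -/

section Cramer

open scoped ENNReal

/-- Every neighbourhood of a point contains a ball of a separable seminorm centered there. -/
def HasSeparableSeminorms (E : Type*) [AddCommGroup E] [Module ℝ E] [TopologicalSpace E]
    [MeasurableSpace E] : Prop :=
  ∀ x : E, ∀ V ∈ 𝓝 x, ∃ q : Seminorm ℝ E, SeparableSeminorm q ∧
    ∃ r > 0, {y | q (y - x) < r} ⊆ V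

variable {E : Type*} [AddCommGroup E] [Module ℝ E] [TopologicalSpace E] [MeasurableSpace E]

/-- Continuity of `φ` at 0 involves a single neighbourhood, hence a single seminorm. -/
theorem HasSeparableSeminorms.exists_dual_le (hE : HasSeparableSeminorms E) (φ : E →L[ℝ] ℝ) :
    ∃ q : Seminorm ℝ E, SeparableSeminorm q ∧ ∃ M : ℝ, 0 ≤ M ∧ ∀ y, φ y ≤ M * q y := by
  have hV : {y | φ y < 1} ∈ 𝓝 (0 : E) :=
    φ.continuous.continuousAt.eventually (gt_mem_nhds (by simp))
  obtain ⟨q, hq, r, hr, hsub⟩ := hE 0 _ hV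
  obtain ⟨M, hM, h⟩ := LinearMap.exists_le_mul_seminorm q (φ : E →ₗ[ℝ] ℝ) hr (C := 1)
    fun y hy => (show φ y < 1 from hsub (by simpa using hy)).le
  exact ⟨q, hq, M, hM, h⟩

variable [MeasurableAdd₂ E]

theorem HasSeparableSeminorms.measurable_dual (hE : HasSeparableSeminorms E) (φ : E →L[ℝ] ℝ) :
    Measurable φ := by
  obtain ⟨q, hq, M, hM, h⟩ := hE.exists_dual_le φ
  exact hq.measurable_linearMap (φ := (φ : E →ₗ[ℝ] ℝ)) hM h

/-- Chebyshev's inequality for the empirical means. -/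
theorem exp_le_lintegral_of_le_convPow (hE : HasSeparableSeminorms E) {μ : Measure E}
    [IsProbabilityMeasure μ] (φ : E →L[ℝ] ℝ) {x : E} {a : ℝ}
    (h : ∀ q : Seminorm ℝ E, SeparableSeminorm q → ∀ r > 0, ∀ᶠ n : ℕ in atTop,
      ENNReal.ofReal (Real.exp (n * a)) ≤ convPow μ n (meanBall q x r n)) :
    ENNReal.ofReal (Real.exp (a + φ x)) ≤ ∫⁻ y, ENNReal.ofReal (Real.exp (φ y)) ∂μ := by
  obtain ⟨q, hq, M, hM, hφM⟩ := hE.exists_dual_le φ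
  have hcont : Continuous fun r : ℝ => ENNReal.ofReal (Real.exp (a + φ x - M * r)) :=
    ENNReal.continuous_ofReal.comp (by fun_prop)
  have ht : Tendsto (fun r : ℝ => ENNReal.ofReal (Real.exp (a + φ x - M * r))) (𝓝[>] 0)
      (𝓝 (ENNReal.ofReal (Real.exp (a + φ x)))) := by
    simpa using (hcont.tendsto 0).mono_left nhdsWithin_le_nhds
  refine le_of_tendsto ht ?_
  filter_upwards [self_mem_nhdsWithin] with r hr
  -- One `n` suffices, the Laplace transform of the convolution power being exactly an `n`-th power.
  obtain ⟨n, hn, hn1⟩ := ((h q hq r hr).and (eventually_ge_atTop 1)).exists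
  have hn0 : (0 : ℝ) < n := by exact_mod_cast hn1
  rw [← ENNReal.pow_le_pow_left_iff (Nat.one_le_iff_ne_zero.1 hn1),
    ← lintegral_convPow_exp μ (hE.measurable_dual φ) (map_zero φ) (map_add φ),
    ← ENNReal.ofReal_pow (Real.exp_pos _).le, ← Real.exp_nat_mul]
  have hB := measurableSet_meanBall hq.measurable x r n
  calc ENNReal.ofReal (Real.exp (n * (a + φ x - M * r)))
      = ENNReal.ofReal (Real.exp (n * φ x - n * (M * r))) * ENNReal.ofReal (Real.exp (n * a)) := by
        rw [← ENNReal.ofReal_mul (Real.exp_pos _).le, ← Real.exp_add]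
        congr 2
        ring
    _ ≤ ENNReal.ofReal (Real.exp (n * φ x - n * (M * r))) *
          convPow μ n (meanBall q x r n) := by gcongr
    _ = ∫⁻ _ in meanBall q x r n, ENNReal.ofReal (Real.exp (n * φ x - n * (M * r)))
          ∂convPow μ n := by rw [setLIntegral_const]
    _ ≤ ∫⁻ y in meanBall q x r n, ENNReal.ofReal (Real.exp (φ y)) ∂convPow μ n := by
        refine setLIntegral_mono' hB fun y hy => ?_
        gcongr
        have h1 := hφM ((n : ℝ) • x - y)
        rw [map_sub, map_smul, smul_eq_mul, map_sub_rev] at h1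
        have h2 := mul_le_mul_of_nonneg_left (mem_meanBall.1 hy).le hM
        linarith
    _ ≤ ∫⁻ y, ENNReal.ofReal (Real.exp (φ y)) ∂convPow μ n := setLIntegral_le_lintegral _ _

variable {Ω : Type*} [MeasurableSpace Ω] {P : Measure Ω}
  [IsProbabilityMeasure P] {X : ℕ → Ω → E}

theorem lintegral_exp_empiricalMean (hX : ∀ i, Measurable (X i)) (hind : iIndepFun X P)
    (hid : ∀ i, IdentDistrib (X i) (X 0) P P) {n : ℕ} (hn : 1 ≤ n) {φ : E →L[ℝ] ℝ}
    (hφ : Measurable φ) :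
    ∫⁻ ω, ENNReal.ofReal (Real.exp (n * φ (empiricalMean X n ω))) ∂P =
      (∫⁻ ω, ENNReal.ofReal (Real.exp (φ (X 0 ω))) ∂P) ^ n := by
  have : IsProbabilityMeasure (P.map (X 0)) :=
    Measure.isProbabilityMeasure_map (hX 0).aemeasurable
  have hm : Measurable fun y => ENNReal.ofReal (Real.exp (φ y)) := by fun_prop
  have hS : Measurable (∑ i ∈ Finset.range n, X i) := by
    simpa only [Finset.sum_fn] using Finset.measurable_fun_sum _ fun i _ => hX i
  have hn0 : (n : ℝ) ≠ 0 := by positivity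
  rw [← lintegral_map hm (hX 0), ← lintegral_convPow_exp _ hφ (map_zero φ) (map_add φ),
    ← map_sum_eq_convPow hX hind (fun i => (hid i).map_eq) n, lintegral_map hm hS]
  refine lintegral_congr fun ω => ?_
  rw [empiricalMean, map_smul, smul_eq_mul, mul_inv_cancel_left₀ hn0, Finset.sum_apply]

theorem pressure_empiricalMean (hX : ∀ i, Measurable (X i)) (hind : iIndepFun X P)
    (hid : ∀ i, IdentDistrib (X i) (X 0) P P) {φ : E →L[ℝ] ℝ} (hφ : Measurable φ) :
    pressure P (empiricalMean X) (fun n => (n : ℝ)) φ =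
      ENNReal.log (∫⁻ ω, ENNReal.ofReal (Real.exp (φ (X 0 ω))) ∂P) := by
  rw [pressure]
  refine (limsup_congr ?_).trans (limsup_const _)
  filter_upwards [eventually_ge_atTop 1] with n hn
  rw [lintegral_exp_empiricalMean hX hind hid hn hφ, ← ENNReal.log_rpow,
    ENNReal.pow_rpow_inv_natCast (Nat.one_le_iff_ne_zero.1 hn)]

variable [MeasurableConstSMul ℝ E]

theorem coe_le_entropy (hE : HasSeparableSeminorms E) (hX : ∀ i, Measurable (X i))
    (hind : iIndepFun X P) (hid : ∀ i, IdentDistrib (X i) (X 0) P P) {x : E} {t : ℝ}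
    (h : ∀ q : Seminorm ℝ E, SeparableSeminorm q → ∀ δ > 0,
      (x, t) ∈ strictHypograph (P.map (X 0)) q δ) :
    (t : EReal) ≤ entropy P (empiricalMean X) (fun n => (n : ℝ)) x := by
  have : IsProbabilityMeasure (P.map (X 0)) :=
    Measure.isProbabilityMeasure_map (hX 0).aemeasurable
  refine le_iInf₂ fun V hV => ?_
  obtain ⟨q, hq, r, hr, hsub⟩ := hE x V hV.1
  obtain ⟨r', hr', t', ht', hc⟩ := h q hq r hr
  refine le_liminf_of_le (by isBoundedDefault) ?_
  filter_upwards [hc.eventually hq.measurable hr' ht', eventually_ge_atTop 1] with n h1 hn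
  rw [EReal.le_inv_mul_log_iff hn]
  rw [← measure_empiricalMean_preimage_ball hq.measurable hX hind hid hn] at h1
  exact h1.trans (measure_mono (Set.preimage_mono hsub))

theorem eventually_of_lt_entropy [IsTopologicalAddGroup E] (hX : ∀ i, Measurable (X i))
    (hind : iIndepFun X P) (hid : ∀ i, IdentDistrib (X i) (X 0) P P) {x : E} {a : ℝ}
    (h : (a : EReal) < entropy P (empiricalMean X) (fun n => (n : ℝ)) x)
    {q : Seminorm ℝ E} (hq : SeparableSeminorm q) {r : ℝ} (hr : 0 < r) :
    ∀ᶠ n : ℕ in atTop, ENNReal.ofReal (Real.exp (n * a)) ≤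
      convPow (P.map (X 0)) n (meanBall q x r n) := by
  have hV : {y | q (y - x) < r} ∈ 𝓝 x ∧ MeasurableSet {y | q (y - x) < r} := by
    refine ⟨?_, by simpa [meanBall] using measurableSet_meanBall hq.measurable x r 1⟩
    have : ContinuousAt (fun y => q (y - x)) x :=
      (hq.continuous.comp (continuous_id.sub continuous_const)).continuousAt
    exact this.eventually (gt_mem_nhds (by simpa using hr))
  have h1 := h.trans_le (iInf₂_le {y | q (y - x) < r} hV)
  filter_upwards [eventually_lt_of_lt_liminf h1, eventually_ge_atTop 1] with n h2 hn
  rw [← measure_empiricalMean_preimage_ball hq.measurable hX hind hid hn]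
  exact (EReal.le_inv_mul_log_iff hn).1 h2.le

/-- The bound holds for every `m ≥ 1`, not only in the limit: a single violation would charge the
ball, hence all slightly larger ones eventually. -/
theorem exists_ball_of_entropy_lt (hE : HasSeparableSeminorms E) (hX : ∀ i, Measurable (X i))
    (hind : iIndepFun X P) (hid : ∀ i, IdentDistrib (X i) (X 0) P P) {x : E} {b : ℝ}
    (h : entropy P (empiricalMean X) (fun n => (n : ℝ)) x < b) :
    ∃ q : Seminorm ℝ E, SeparableSeminorm q ∧ ∃ r > 0, ∀ m : ℕ, 1 ≤ m →
      P (empiricalMean X m ⁻¹' {y | q (y - x) < r}) ≤ ENNReal.ofReal (Real.exp (m * b)) := by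
  obtain ⟨t, ht, htb⟩ := EReal.lt_iff_exists_real_btwn.1 h
  have hnot := mt (coe_le_entropy hE hX hind hid) ht.not_ge
  push Not at hnot
  obtain ⟨q, hq, δ, hδ, hx⟩ := hnot
  refine ⟨q, hq, δ / 2, half_pos hδ, fun m hm => ?_⟩
  by_contra! hlt
  rw [measure_empiricalMean_preimage_ball hq.measurable hX hind hid hm] at hlt
  exact hx ⟨δ / 2, half_lt_self hδ, b, EReal.coe_lt_coe_iff.1 htb, m, hm, hlt.le⟩

theorem limsup_empiricalMean_le_of_isCompact [IsTopologicalAddGroup E]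
    (hE : HasSeparableSeminorms E)
    (hX : ∀ i, Measurable (X i)) (hind : iIndepFun X P)
    (hid : ∀ i, IdentDistrib (X i) (X 0) P P) {K : Set E} (hK : IsCompact (closure K)) :
    limsup (fun n : ℕ => (((n : ℝ)⁻¹ : ℝ) : EReal) * ENNReal.log (P (empiricalMean X n ⁻¹' K)))
      atTop ≤ ⨆ x ∈ closure K, entropy P (empiricalMean X) (fun n => (n : ℝ)) x := by
  refine le_of_forall_gt fun c hc => ?_
  obtain ⟨b, hb, hbc⟩ := EReal.lt_iff_exists_real_btwn.1 hc
  -- The gap between `b` and `b'` absorbs the number of balls in the cover.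
  obtain ⟨b', hb', hbc'⟩ := EReal.lt_iff_exists_real_btwn.1 hbc
  refine lt_of_le_of_lt ?_ hbc'
  have hx : ∀ x ∈ closure K, ∃ q : Seminorm ℝ E, SeparableSeminorm q ∧ ∃ r > 0, ∀ m : ℕ, 1 ≤ m →
      P (empiricalMean X m ⁻¹' {y | q (y - x) < r}) ≤ ENNReal.ofReal (Real.exp (m * b)) :=
    fun x hx => exists_ball_of_entropy_lt hE hX hind hid
      ((le_iSup₂ (f := fun x (_ : x ∈ closure K) =>
        entropy P (empiricalMean X) (fun n => (n : ℝ)) x) x hx).trans_lt hb)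
  choose! q hq r hr hP using hx
  obtain ⟨s, hs, hcov⟩ := hK.elim_nhds_subcover (fun x => {y | q x (y - x) < r x})
    fun x hx => by
      have : ContinuousAt (fun y => q x (y - x)) x :=
        ((hq x hx).continuous.comp (continuous_id.sub continuous_const)).continuousAt
      exact this.eventually (gt_mem_nhds (by simpa using hr x hx))
  have hbb' : 0 < b' - b := sub_pos.2 (EReal.coe_lt_coe_iff.1 hb')
  have e1 : ∀ᶠ n : ℕ in atTop, (s.card : ℝ) ≤ n * (b' - b) :=
    (tendsto_natCast_atTop_atTop.atTop_mul_const hbb').eventually_ge_atTop _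
  refine limsup_le_of_le (by isBoundedDefault) ?_
  filter_upwards [e1, eventually_ge_atTop 1] with n h1 hn
  rw [EReal.inv_mul_log_le_iff hn]
  have hsub : empiricalMean X n ⁻¹' K ⊆
      ⋃ x ∈ s, empiricalMean X n ⁻¹' {y | q x (y - x) < r x} := by
    intro ω hω
    obtain ⟨x, hx, h⟩ := Set.mem_iUnion₂.1 (hcov (subset_closure hω))
    exact Set.mem_iUnion₂.2 ⟨x, hx, h⟩
  refine (measure_mono hsub).trans ((measure_biUnion_finset_le _ _).trans
    ((Finset.sum_le_card_nsmul _ _ _ fun x hx => hP x (hs x hx) n hn).trans ?_))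
  rw [nsmul_eq_mul, ← ENNReal.ofReal_natCast, ← ENNReal.ofReal_mul (Nat.cast_nonneg _)]
  refine ENNReal.ofReal_le_ofReal ?_
  have h2 : (s.card : ℝ) ≤ Real.exp (n * (b' - b)) := by
    linarith [Real.add_one_le_exp ((n : ℝ) * (b' - b))]
  calc (s.card : ℝ) * Real.exp (n * b) ≤ Real.exp (n * (b' - b)) * Real.exp (n * b) := by gcongr
    _ = Real.exp (n * b') := by rw [← Real.exp_add]; congr 1; ring

/-- The entropy of the empirical means is the opposite of the Fenchel-Legendre transform of their
pressure. -/
theorem entropy_empiricalMean [IsTopologicalAddGroup E] [ContinuousSMul ℝ E]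
    (hE : HasSeparableSeminorms E) (hX : ∀ i, Measurable (X i)) (hind : iIndepFun X P)
    (hid : ∀ i, IdentDistrib (X i) (X 0) P P) (x : E) :
    entropy P (empiricalMean X) (fun n => (n : ℝ)) x =
      -fenchelLegendre (pressure P (empiricalMean X) (fun n => (n : ℝ))) x := by
  have : IsProbabilityMeasure (P.map (X 0)) :=
    Measure.isProbabilityMeasure_map (hX 0).aemeasurable
  have hp : ∀ φ : E →L[ℝ] ℝ, pressure P (empiricalMean X) (fun n => (n : ℝ)) φ =
      ENNReal.log (∫⁻ y, ENNReal.ofReal (Real.exp (φ y)) ∂P.map (X 0)) := fun φ => by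
    have hφ := hE.measurable_dual φ
    rw [pressure_empiricalMean hX hind hid hφ, lintegral_map (by fun_prop) (hX 0)]
  have hlog : ∀ a : ℝ, ENNReal.log (ENNReal.ofReal (Real.exp a)) = a := fun a => by
    rw [ENNReal.log_ofReal_of_pos (Real.exp_pos a), Real.log_exp]
  refine le_antisymm ?_ ?_
  -- The inequality is brought to `s ≤ -(φ x - p φ)`, then tested on reals `a < s`, so that
  -- Chebyshev's inequality applies to finite rates.
  · rw [EReal.le_neg]
    refine iSup_le fun φ => ?_
    rw [EReal.le_neg]
    refine le_of_forall_lt fun c hc => ?_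
    obtain ⟨a, hca, ha⟩ := EReal.lt_iff_exists_real_btwn.1 hc
    refine hca.trans_le ?_
    rw [EReal.le_neg]
    have h1 := ENNReal.log_monotone (exp_le_lintegral_of_le_convPow hE φ (x := x) (a := a)
      fun q hq r hr => eventually_of_lt_entropy hX hind hid ha hq hr)
    rw [hlog, ← hp] at h1
    refine (EReal.sub_le_sub le_rfl h1).trans_eq ?_
    rw [← EReal.coe_sub, ← EReal.coe_neg]
    congr 1
    ring
  · refine le_of_forall_lt fun c hc => ?_
    obtain ⟨t, hct, ht⟩ := EReal.lt_iff_exists_real_btwn.1 hc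
    refine hct.trans_le ?_
    by_contra hnot
    have := mt (coe_le_entropy hE hX hind hid) hnot
    push Not at this
    obtain ⟨q, hq, δ, hδ, hx⟩ := this
    obtain ⟨φ, hφ⟩ := exists_dual_of_notMem_strictHypograph hq hδ hx
    have h1 := ENNReal.log_monotone hφ
    rw [hlog, ← hp] at h1
    refine ht.not_ge ?_
    rw [EReal.neg_le]
    refine le_trans ?_ (le_iSup (fun φ : E →L[ℝ] ℝ => ((φ x : ℝ) : EReal) -
      pressure P (empiricalMean X) (fun n => (n : ℝ)) φ) φ)
    refine le_trans (le_of_eq ?_) (EReal.sub_le_sub le_rfl h1)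
    rw [← EReal.coe_sub, ← EReal.coe_neg]
    congr 1
    ring

/-- Cramér's theorem in a topological vector space whose topology is generated by separable
seminorms. -/
theorem cramerConclusion_of_hasSeparableSeminorms [IsTopologicalAddGroup E] [ContinuousSMul ℝ E]
    (hE : HasSeparableSeminorms E) (hX : ∀ i, Measurable (X i)) (hind : iIndepFun X P)
    (hid : ∀ i, IdentDistrib (X i) (X 0) P P) : CramerConclusion P X where
  measurable_mean := measurable_empiricalMean hX
  measurable_dual := hE.measurable_dual
  weakLDP :=
    -- `G` is itself one of the neighbourhoods in the infimum defining the entropy.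
    { lower := fun G hG => iSup₂_le fun _ hx =>
        iInf₂_le G ⟨mem_interior_iff_mem_nhds.1 hx, hG⟩
      upper := fun _ _ hK => limsup_empiricalMean_le_of_isCompact hE hX hind hid hK }
  entropy_eq := entropy_empiricalMean hE hX hind hid
  pressure_eq := fun φ => pressure_empiricalMean hX hind hid (hE.measurable_dual φ)

end Cramer

/-! ### Gauges of algebraically open convex sets -/

section SeminormBalls

variable {E : Type*} [AddCommGroup E] [Module ℝ E]

theorem absorbent_of_algebraicallyOpen {C : Set E} (h0 : (0 : E) ∈ C)
    (hopen : AlgebraicallyOpen C) : Absorbent ℝ C := by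
  intro x
  obtain ⟨ε, hε, h⟩ := hopen 0 h0 x
  refine absorbs_iff_norm.2 ⟨2 / ε, fun c hc => Set.singleton_subset_iff.2 ?_⟩
  have hc0 : 0 < ‖c‖ := lt_of_lt_of_le (by positivity) hc
  rw [Set.mem_smul_set_iff_inv_smul_mem₀ (norm_pos_iff.1 hc0)]
  simpa using h c⁻¹ (by
    rw [abs_inv, ← Real.norm_eq_abs, inv_lt_comm₀ hc0 hε]
    refine lt_of_lt_of_le ?_ hc
    rw [inv_eq_one_div]
    gcongr
    norm_num)

/-- A symmetric, algebraically open, convex set containing the origin is the open unit ball of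
a seminorm. -/
theorem exists_seminorm_of_algebraicallyOpen {C : Set E} (h0 : (0 : E) ∈ C)
    (hsymm : ∀ x ∈ C, -x ∈ C) (hconv : Convex ℝ C) (hopen : AlgebraicallyOpen C) :
    ∃ p : Seminorm ℝ E, ∀ y, p y < 1 ↔ y ∈ C := by
  have habs := absorbent_of_algebraicallyOpen h0 hopen
  refine ⟨gaugeSeminorm ((balanced_iff_neg_mem hconv).2 fun x => hsymm x) hconv habs, fun y => ?_⟩
  change gauge C y < 1 ↔ y ∈ C
  refine ⟨fun h => setOfPred_gauge_lt_one_subset_self hconv h0 habs h, fun hy => ?_⟩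
  -- Openness in the direction of `y` itself pushes `y` outwards inside `C`, so its gauge is
  -- strictly below 1.
  obtain ⟨ε, hε, h⟩ := hopen y hy y
  have h1 : y + (ε / 2) • y ∈ C := h _ (by rw [abs_of_pos (by positivity)]; linarith)
  have h2 : y ∈ (1 + ε / 2)⁻¹ • C := by
    refine ⟨_, h1, ?_⟩
    have : y + (ε / 2) • y = (1 + ε / 2) • y := by rw [add_smul, one_smul]
    change (1 + ε / 2)⁻¹ • (y + (ε / 2) • y) = y
    rw [this, inv_smul_smul₀ (by positivity)]
  refine (gauge_le_of_mem (by positivity) h2).trans_lt (inv_lt_one_of_one_lt₀ ?_)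
  linarith

theorem mem_vadd_smul_iff_seminorm {C : Set E} {p : Seminorm ℝ E} (hp : ∀ y, p y < 1 ↔ y ∈ C)
    {l : ℝ} (hl : 0 < l) (x y : E) : y - x ∈ l • C ↔ p (y - x) < l := by
  rw [Set.mem_smul_set_iff_inv_smul_mem₀ hl.ne', ← hp, map_smul_eq_mul,
    Real.norm_of_nonneg (by positivity), inv_mul_lt_iff₀ hl, mul_one]

end SeminormBalls

/-! ### Comparison principles for `τ(𝒞)` and `ℱ(𝒞)` -/

section LCTopology

variable {E : Type*} [AddCommGroup E] [Module ℝ E] {𝒞 : Set (Set E)}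

theorem mem_vadd_iInter_smul {r : ℕ} {C : Fin r → Set E} {l : Fin r → ℝ} {x y : E} :
    (y ∈ x +ᵥ ⋂ i, l i • C i) ↔ ∀ i, y - x ∈ l i • C i := by
  rw [Set.mem_vadd_set_iff_neg_vadd_mem, vadd_eq_add, neg_add_eq_sub, Set.mem_iInter]

theorem vadd_iInter_smul_eq {r : ℕ} {C : Fin r → Set E} {l : Fin r → ℝ} {x : E} :
    (x +ᵥ ⋂ i, l i • C i) = ⋂ i, {y | y - x ∈ l i • C i} := by
  ext y
  rw [mem_vadd_iInter_smul, Set.mem_iInter]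
  rfl

theorem basicNhds_singleton {C : Set E} (hC : C ∈ 𝒞) {l : ℝ} (hl : 0 < l) (x : E) :
    {y | y - x ∈ l • C} ∈ basicNhds 𝒞 x := by
  refine ⟨1, fun _ => C, fun _ => l, fun _ => hC, fun _ => hl, ?_⟩
  rw [vadd_iInter_smul_eq, Set.iInter_const]

/-- `τ(𝒞)` is the coarsest translation-invariant and dilation-invariant topology in which the
elements of `𝒞` are open. -/
theorem le_lcTopology {t : TopologicalSpace E} (h0 : ∀ C ∈ 𝒞, (0 : E) ∈ C)
    (h : ∀ C ∈ 𝒞, ∀ x : E, ∀ l : ℝ, 0 < l → IsOpen[t] {y | y - x ∈ l • C}) :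
    t ≤ lcTopology 𝒞 := by
  intro U hU
  refine (@isOpen_iff_mem_nhds E t U).2 fun x hx => ?_
  obtain ⟨V, ⟨r, C, l, hC, hl, rfl⟩, hVU⟩ := hU x hx
  refine @mem_of_superset _ (@nhds E t x) _ _ (@IsOpen.mem_nhds E t _ _ ?_ ?_) hVU
  · rw [vadd_iInter_smul_eq]
    exact @isOpen_iInter_of_finite E (Fin r) t _ _ fun i => h _ (hC i) _ _ (hl i)
  · rw [mem_vadd_iInter_smul]
    intro i
    rw [sub_self]
    exact ⟨0, h0 _ (hC i), smul_zero _⟩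

theorem measurable_lcSigmaAlgebra [ℱ : MeasurableSpace E] (hℱ : ℱ = lcSigmaAlgebra 𝒞)
    {α : Type*} [MeasurableSpace α] {f : α → E}
    (h : ∀ C ∈ 𝒞, ∀ x : E, ∀ l : ℝ, 0 < l → MeasurableSet {a | f a - x ∈ l • C}) :
    Measurable f := by
  subst hℱ
  refine measurable_generateFrom fun V hV => ?_
  obtain ⟨x, r, C, l, hC, hl, rfl⟩ := Set.mem_iUnion.1 hV
  rw [vadd_iInter_smul_eq, Set.preimage_iInter]
  exact MeasurableSet.iInter fun i => h _ (hC i) _ _ (hl i)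

theorem measurableSet_lcSigmaAlgebra [ℱ : MeasurableSpace E] (hℱ : ℱ = lcSigmaAlgebra 𝒞)
    {C : Set E} (hC : C ∈ 𝒞) {l : ℝ} (hl : 0 < l) (x : E) :
    MeasurableSet {y | y - x ∈ l • C} := by
  subst hℱ
  exact MeasurableSpace.measurableSet_generateFrom (Set.mem_iUnion.2 ⟨x, basicNhds_singleton hC hl x⟩)

end LCTopology

/-! ### Sums of separable seminorms -/

section SeparableSeminormSums

variable {E : Type*} [AddCommGroup E] [Module ℝ E]
  [TopologicalSpace E] [MeasurableSpace E]

theorem SeparableSeminorm.zero : SeparableSeminorm (0 : Seminorm ℝ E) where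
  continuous := continuous_const
  measurable := measurable_const
  separable := ⟨{0}, Set.countable_singleton 0, fun _ _ hε => ⟨0, rfl, hε⟩⟩

theorem SeparableSeminorm.add {q₁ q₂ : Seminorm ℝ E} (h₁ : SeparableSeminorm q₁)
    (h₂ : SeparableSeminorm q₂) : SeparableSeminorm (q₁ + q₂) where
  continuous := h₁.continuous.add h₂.continuous
  measurable := h₁.measurable.add h₂.measurable
  separable := by
    obtain ⟨D₁, hD₁, hd₁⟩ := h₁.separable
    obtain ⟨D₂, hD₂, hd₂⟩ := h₂.separable
    -- No point need be close to both `d₁` and `d₂`; one is selected for each pair and precision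
    -- whenever it exists, and 0 otherwise.
    have : ∀ a : (E × E) × ℕ, ∃ z : E, (∃ w, q₁ (w - a.1.1) < 1 / ((a.2 : ℝ) + 1) ∧
        q₂ (w - a.1.2) < 1 / ((a.2 : ℝ) + 1)) →
        q₁ (z - a.1.1) < 1 / ((a.2 : ℝ) + 1) ∧ q₂ (z - a.1.2) < 1 / ((a.2 : ℝ) + 1) := by
      intro a
      by_cases h : ∃ w, q₁ (w - a.1.1) < 1 / ((a.2 : ℝ) + 1) ∧ q₂ (w - a.1.2) < 1 / ((a.2 : ℝ) + 1)
      · obtain ⟨w, hw⟩ := h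
        exact ⟨w, fun _ => hw⟩
      · exact ⟨0, fun h' => absurd h' h⟩
    choose z hz using this
    refine ⟨z '' ((D₁ ×ˢ D₂) ×ˢ Set.univ), ((hD₁.prod hD₂).prod Set.countable_univ).image z,
      fun x ε hε => ?_⟩
    obtain ⟨n, hn⟩ := exists_nat_one_div_lt (show 0 < ε / 4 by positivity)
    obtain ⟨d₁, hdD₁, hx₁⟩ := hd₁ x (1 / ((n : ℝ) + 1)) Nat.one_div_pos_of_nat
    obtain ⟨d₂, hdD₂, hx₂⟩ := hd₂ x (1 / ((n : ℝ) + 1)) Nat.one_div_pos_of_nat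
    obtain ⟨h1, h2⟩ := hz ((d₁, d₂), n) ⟨x, hx₁, hx₂⟩
    refine ⟨_, ⟨((d₁, d₂), n), ⟨⟨hdD₁, hdD₂⟩, trivial⟩, rfl⟩, ?_⟩
    have h3 := map_sub_le_add q₁ (x - d₁) (z ((d₁, d₂), n) - d₁)
    have h4 := map_sub_le_add q₂ (x - d₂) (z ((d₁, d₂), n) - d₂)
    rw [sub_sub_sub_cancel_right] at h3 h4
    change q₁ _ + q₂ _ < ε
    simp only at h1 h2
    linarith

end SeparableSeminormSums

/-! ### Locally convex separable spaces satisfy the hypotheses -/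

section UnitBallSeminorms

variable {E : Type*} [AddCommGroup E] [Module ℝ E] {𝒞 : Set (Set E)}

/-- The elements of `𝒞` are the open unit balls of the seminorms `p`. -/
def AreUnitBalls (𝒞 : Set (Set E)) (p : Set E → Seminorm ℝ E) : Prop :=
  ∀ C ∈ 𝒞, ∀ y, p C y < 1 ↔ y ∈ C

theorem IsLCSFamily.exists_areUnitBalls (h : IsLCSFamily 𝒞) : ∃ p, AreUnitBalls 𝒞 p := by
  have : ∀ C ∈ 𝒞, ∃ p : Seminorm ℝ E, ∀ y, p y < 1 ↔ y ∈ C := fun C hC =>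
    exists_seminorm_of_algebraicallyOpen (h.zero_mem C hC) (h.symmetric C hC) (h.convex C hC)
      (h.algebraicallyOpen C hC)
  choose! p hp using this
  exact ⟨p, hp⟩

variable {p : Set E → Seminorm ℝ E}

theorem AreUnitBalls.mem_iff (hp : AreUnitBalls 𝒞 p) {C : Set E} (hC : C ∈ 𝒞) {l : ℝ} (hl : 0 < l)
    (x y : E) : y - x ∈ l • C ↔ p C (y - x) < l :=
  mem_vadd_smul_iff_seminorm (hp C hC) hl x y

theorem AreUnitBalls.isOpen (hp : AreUnitBalls 𝒞 p) {C : Set E} (hC : C ∈ 𝒞) (x : E) (l : ℝ) :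
    IsOpen[lcTopology 𝒞] {y | p C (y - x) < l} := by
  intro z hz
  have hz' : 0 < l - p C (z - x) := sub_pos.2 hz
  refine ⟨_, basicNhds_singleton hC hz' z, fun y hy => ?_⟩
  have h1 := (hp.mem_iff hC hz' z y).1 hy
  have h2 := map_add_le_add (p C) (y - z) (z - x)
  rw [sub_add_sub_cancel] at h2
  change p C (y - x) < l
  linarith

theorem AreUnitBalls.tendsto_iff [τ : TopologicalSpace E] (hp : AreUnitBalls 𝒞 p)
    (hτ : τ = lcTopology 𝒞) {ι : Type*} {f : ι → E} {F : Filter ι} {x : E} :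
    Tendsto f F (𝓝 x) ↔ ∀ C ∈ 𝒞, ∀ l > 0, ∀ᶠ i in F, p C (f i - x) < l := by
  have hopen : ∀ U, IsOpen U ↔ IsOpen[lcTopology 𝒞] U := fun U => by rw [hτ]
  refine ⟨fun h C hC l hl => h (((hopen _).2 (hp.isOpen hC x l)).mem_nhds (by simpa using hl)),
    fun h V hV => ?_⟩
  obtain ⟨U, hUV, hU, hx⟩ := mem_nhds_iff.1 hV
  rw [hopen] at hU
  obtain ⟨W, ⟨r, C, l, hC, hl, rfl⟩, hWU⟩ := hU x hx
  have h1 : ∀ᶠ i in F, ∀ j, p (C j) (f i - x) < l j :=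
    eventually_all.2 fun j => h _ (hC j) _ (hl j)
  refine h1.mono fun i hi => hUV (hWU ?_)
  exact mem_vadd_iInter_smul.2 fun j => (hp.mem_iff (hC j) (hl j) x (f i)).2 (hi j)

theorem AreUnitBalls.isTopologicalAddGroup [τ : TopologicalSpace E] (hp : AreUnitBalls 𝒞 p)
    (hτ : τ = lcTopology 𝒞) : IsTopologicalAddGroup E where
  continuous_add := by
    refine continuous_iff_continuousAt.2 fun z => (hp.tendsto_iff hτ).2 fun C hC l hl => ?_
    have h1 := (hp.tendsto_iff hτ).1 (continuous_fst.tendsto z) C hC (l / 2) (half_pos hl)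
    have h2 := (hp.tendsto_iff hτ).1 (continuous_snd.tendsto z) C hC (l / 2) (half_pos hl)
    filter_upwards [h1, h2] with w h1 h2
    have := map_add_le_add (p C) (w.1 - z.1) (w.2 - z.2)
    rw [add_sub_add_comm]
    linarith
  continuous_neg := by
    refine continuous_iff_continuousAt.2 fun z => (hp.tendsto_iff hτ).2 fun C hC l hl => ?_
    have h1 := (hp.tendsto_iff hτ).1 (continuous_id.tendsto z) C hC l hl
    filter_upwards [h1] with w h1
    rwa [neg_sub_neg, map_sub_rev]

theorem AreUnitBalls.continuousSMul [τ : TopologicalSpace E] (hp : AreUnitBalls 𝒞 p)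
    (hτ : τ = lcTopology 𝒞) : ContinuousSMul ℝ E where
  continuous_smul := by
    refine continuous_iff_continuousAt.2 fun z => (hp.tendsto_iff hτ).2 fun C hC l hl => ?_
    have hz : 0 < |z.1| + 1 := by positivity
    have h1 := (hp.tendsto_iff hτ).1 (continuous_snd.tendsto z) C hC (l / 2 / (|z.1| + 1))
      (by positivity)
    have h2 : ∀ᶠ w : ℝ × E in 𝓝 z, |w.1| < |z.1| + 1 :=
      (continuous_fst.abs.tendsto z).eventually (gt_mem_nhds (lt_add_one _))
    have h3 : ∀ᶠ w : ℝ × E in 𝓝 z, |w.1 - z.1| * p C z.2 < l / 2 := by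
      have : ContinuousAt (fun w : ℝ × E => |w.1 - z.1| * p C z.2) z := by fun_prop
      exact this.eventually (gt_mem_nhds (by simpa using half_pos hl))
    filter_upwards [h1, h2, h3] with w h1 h2 h3
    have h4 : w.1 • w.2 - z.1 • z.2 = w.1 • (w.2 - z.2) + (w.1 - z.1) • z.2 := by
      rw [smul_sub, sub_smul]; abel
    have h5 := map_add_le_add (p C) (w.1 • (w.2 - z.2)) ((w.1 - z.1) • z.2)
    rw [map_smul_eq_mul, map_smul_eq_mul, Real.norm_eq_abs, Real.norm_eq_abs] at h5
    have h6 : |w.1| * p C (w.2 - z.2) ≤ (|z.1| + 1) * p C (w.2 - z.2) := by gcongr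
    rw [lt_div_iff₀ hz] at h1
    change p C (w.1 • w.2 - z.1 • z.2) < l
    rw [h4]
    linarith

theorem AreUnitBalls.separable (hp : AreUnitBalls 𝒞 p) {C : Set E} (hC : C ∈ 𝒞)
    (hsep : @TopologicalSpace.SeparableSpace E (lcTopology {C})) :
    ∃ D : Set E, D.Countable ∧ ∀ x, ∀ ε > 0, ∃ d ∈ D, p C (x - d) < ε := by
  let _ : TopologicalSpace E := lcTopology {C}
  obtain ⟨D, hD, hdense⟩ := TopologicalSpace.exists_countable_dense E
  refine ⟨D, hD, fun x ε hε => ?_⟩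
  have hpC : AreUnitBalls {C} p := fun C' hC' => by
    rw [Set.mem_singleton_iff.1 hC']
    exact hp C hC
  obtain ⟨d, hdD, hd⟩ := hdense.exists_mem_open (hpC.isOpen rfl x ε) ⟨x, by simpa using hε⟩
  exact ⟨d, hdD, by rw [map_sub_rev]; exact hd⟩

theorem AreUnitBalls.measurable [ℱ : MeasurableSpace E] (hp : AreUnitBalls 𝒞 p)
    (hℱ : ℱ = lcSigmaAlgebra 𝒞) {C : Set E} (hC : C ∈ 𝒞) : Measurable (p C) := by
  refine measurable_of_Iio fun l => ?_
  rcases le_or_gt l 0 with hl | hl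
  · convert MeasurableSet.empty
    ext y
    simpa using hl.trans (apply_nonneg (p C) y)
  · convert measurableSet_lcSigmaAlgebra hℱ hC hl 0
    ext y
    rw [Set.mem_ofPred_eq, hp.mem_iff hC hl, sub_zero]
    rfl

/-- Separability is essential: it writes the preimage of a ball under addition as a countable union
of products of balls. -/
theorem IsLCSFamily.measurableAdd₂ [ℱ : MeasurableSpace E] (h : IsLCSFamily 𝒞)
    (hℱ : ℱ = lcSigmaAlgebra 𝒞) : MeasurableAdd₂ E := by
  obtain ⟨p, hp⟩ := h.exists_areUnitBalls
  refine ⟨measurable_lcSigmaAlgebra hℱ fun C hC x l hl => ?_⟩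
  obtain ⟨D, hD, hdense⟩ := hp.separable hC (h.separable C hC)
  have hball : ∀ (x : E) (s : ℝ), MeasurableSet {y | p C (y - x) < s} := by
    intro x s
    rcases le_or_gt s 0 with hs | hs
    · convert MeasurableSet.empty
      ext y
      simpa using hs.trans (apply_nonneg (p C) (y - x))
    · simpa only [hp.mem_iff hC hs] using measurableSet_lcSigmaAlgebra hℱ hC hs x
  have key : {a : E × E | a.1 + a.2 - x ∈ l • C} = ⋃ d ∈ D, ⋃ s : ℚ,
      {y | p C (y - d) < (s : ℝ)} ×ˢ {y | p C (y - (x - d)) < l - s} := by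
    ext ⟨a, b⟩
    rw [Set.mem_ofPred_eq, hp.mem_iff hC hl]
    simp only [Set.mem_iUnion, Set.mem_prod, Set.mem_ofPred_eq, exists_prop]
    constructor
    · intro hab
      -- With `s` below half the gap, replacing `a` by `d` costs `s` and still leaves `b` in the
      -- ball of radius `l - s`.
      obtain ⟨s, hs0, hs⟩ := exists_rat_btwn (half_pos (sub_pos.2 hab))
      obtain ⟨d, hd, had⟩ := hdense a s hs0
      refine ⟨d, hd, s, had, ?_⟩
      have h1 := map_sub_le_add (p C) (a + b - x) (a - d)
      have h2 : a + b - x - (a - d) = b - (x - d) := by abel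
      rw [h2] at h1
      linarith
    · rintro ⟨d, -, s, h1, h2⟩
      have h3 := map_add_le_add (p C) (a - d) (b - (x - d))
      have h4 : a - d + (b - (x - d)) = a + b - x := by abel
      rw [h4] at h3
      linarith
  rw [key]
  exact MeasurableSet.biUnion hD fun d _ => MeasurableSet.iUnion fun s =>
    (hball _ _).prod (hball _ _)

theorem IsLCSFamily.measurableConstSMul [ℱ : MeasurableSpace E] (h : IsLCSFamily 𝒞)
    (hℱ : ℱ = lcSigmaAlgebra 𝒞) : MeasurableConstSMul ℝ E := by
  refine ⟨fun c => measurable_lcSigmaAlgebra hℱ fun C hC x l hl => ?_⟩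
  rcases eq_or_ne c 0 with rfl | hc
  · simp only [zero_smul]
    exact MeasurableSet.const _
  · obtain ⟨p, hp⟩ := h.exists_areUnitBalls
    have hl' : 0 < |c|⁻¹ * l := by positivity
    convert measurableSet_lcSigmaAlgebra hℱ hC hl' (c⁻¹ • x) using 3 with y
    have : c • y - x = c • (y - c⁻¹ • x) := by rw [smul_sub, smul_inv_smul₀ hc]
    rw [hp.mem_iff hC hl, hp.mem_iff hC hl', this, map_smul_eq_mul, Real.norm_eq_abs,
      lt_inv_mul_iff₀ (by positivity)]

theorem AreUnitBalls.separableSeminorm {τ : TopologicalSpace E} {ℱ : MeasurableSpace E}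
    (h : IsLCSFamily 𝒞) (hp : AreUnitBalls 𝒞 p) (hτ : τ = lcTopology 𝒞)
    (hℱ : ℱ = lcSigmaAlgebra 𝒞) {C : Set E} (hC : C ∈ 𝒞) : SeparableSeminorm (p C) where
  continuous := by
    refine continuous_iff_continuousAt.2 fun x => Metric.tendsto_nhds.2 fun l hl => ?_
    have h1 := (hp.tendsto_iff hτ).1 (continuous_id.tendsto x) C hC l hl
    filter_upwards [h1] with y hy
    exact (abs_sub_map_le_sub (p C) y x).trans_lt hy
  measurable := hp.measurable hℱ hC
  separable := hp.separable hC (h.separable C hC)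

theorem IsLCSFamily.hasSeparableSeminorms {τ : TopologicalSpace E} {ℱ : MeasurableSpace E}
    (h : IsLCSFamily 𝒞) (hτ : τ = lcTopology 𝒞) (hℱ : ℱ = lcSigmaAlgebra 𝒞) :
    HasSeparableSeminorms E := by
  obtain ⟨p, hp⟩ := h.exists_areUnitBalls
  intro x V hV
  obtain ⟨U, hUV, hU, hx⟩ := mem_nhds_iff.1 hV
  rw [hτ] at hU
  obtain ⟨W, ⟨n, C, l, hC, hl, rfl⟩, hWU⟩ := hU x hx
  -- Choosing `r` eventually small, not as a minimum, covers the empty family.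
  have h1 : ∀ᶠ r : ℝ in 𝓝[>] 0, ∀ j, r < l j :=
    eventually_all.2 fun j => mem_of_superset (Ioo_mem_nhdsGT (hl j)) fun r hr => hr.2
  obtain ⟨r, hr, hr0⟩ := (h1.and self_mem_nhdsWithin).exists
  refine ⟨∑ j, p (C j), Finset.sum_induction _ _ (fun _ _ => SeparableSeminorm.add)
    SeparableSeminorm.zero fun j _ => hp.separableSeminorm h hτ hℱ (hC j), r, hr0,
    fun y hy => hUV (hWU (mem_vadd_iInter_smul.2 fun j => ?_))⟩
  rw [hp.mem_iff (hC j) (hl j)]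
  have h2 : (∑ j, p (C j)) (y - x) < r := hy
  have h3 : p (C j) ≤ ∑ j, p (C j) :=
    (Finset.le_sup (f := fun j => p (C j)) (Finset.mem_univ j)).trans
      (Seminorm.finset_sup_le_sum _ _)
  exact ((h3 (y - x)).trans_lt h2).trans (hr j)

/-- Cramér's theorem in a locally convex separable space. -/
theorem IsLCSFamily.cramerConclusion {Ω : Type*} {τ : TopologicalSpace E} {ℱ : MeasurableSpace E}
    [MeasurableSpace Ω] (h : IsLCSFamily 𝒞) (hτ : τ = lcTopology 𝒞)
    (hℱ : ℱ = lcSigmaAlgebra 𝒞) {P : Measure Ω} [IsProbabilityMeasure P] {X : ℕ → Ω → E}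
    (hX : ∀ i, Measurable (X i)) (hind : iIndepFun X P)
    (hid : ∀ i, IdentDistrib (X i) (X 0) P P) : CramerConclusion P X := by
  obtain ⟨p, hp⟩ := h.exists_areUnitBalls
  have := hp.isTopologicalAddGroup hτ
  have := hp.continuousSMul hτ
  have := h.measurableAdd₂ hℱ
  have := h.measurableConstSMul hℱ
  exact cramerConclusion_of_hasSeparableSeminorms (h.hasSeparableSeminorms hτ hℱ) hX hind hid

end UnitBallSeminorms

/-! ### Families of seminorm balls -/

section SeminormUnitBalls

variable {E : Type*} [AddCommGroup E] [Module ℝ E]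

theorem Seminorm.algebraicallyOpen_lt_one (p : Seminorm ℝ E) : AlgebraicallyOpen {x | p x < 1} := by
  intro x hx y
  have hx' : p x < 1 := hx
  have hy : 0 ≤ p y := apply_nonneg _ _
  refine ⟨(1 - p x) / (p y + 1), div_pos (sub_pos.2 hx') (by positivity), fun t ht => ?_⟩
  rw [lt_div_iff₀ (by positivity)] at ht
  have h1 := map_add_le_add p x (t • y)
  rw [map_smul_eq_mul, Real.norm_eq_abs] at h1
  have := abs_nonneg t
  change p (x + t • y) < 1
  linarith

theorem Seminorm.convex_lt_one (p : Seminorm ℝ E) : Convex ℝ {x | p x < 1} := by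
  simpa using p.convexOn.convex_lt 1

theorem isLCSFamily_of_seminorms {𝒞 : Set (Set E)}
    (h : ∀ C ∈ 𝒞, (∃ p : Seminorm ℝ E, C = {x | p x < 1}) ∧
      @TopologicalSpace.SeparableSpace E (lcTopology {C})) : IsLCSFamily 𝒞 where
  zero_mem C hC := by
    obtain ⟨p, rfl⟩ := (h C hC).1
    simp
  symmetric C hC := by
    obtain ⟨p, rfl⟩ := (h C hC).1
    simp
  convex C hC := by
    obtain ⟨p, rfl⟩ := (h C hC).1
    exact p.convex_lt_one
  algebraicallyOpen C hC := by
    obtain ⟨p, rfl⟩ := (h C hC).1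
    exact p.algebraicallyOpen_lt_one
  separable C hC := (h C hC).2

end SeminormUnitBalls

/-! ### Separable normed spaces -/

section NormedSpaces

variable {N : Type*} [NormedAddCommGroup N] [NormedSpace ℝ N]

theorem setOf_sub_mem_smul_unitBall {l : ℝ} (hl : 0 < l) (x : N) :
    {y | y - x ∈ l • Metric.ball (0 : N) 1} = Metric.ball x l := by
  ext y
  rw [smul_unitBall_of_pos hl, Set.mem_ofPred_eq, mem_ball_zero_iff, mem_ball_iff_norm]

theorem lcTopology_unitBall :
    lcTopology {Metric.ball (0 : N) 1} = (inferInstance : TopologicalSpace N) := by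
  refine le_antisymm (fun U hU x hx => ?_) (le_lcTopology ?_ ?_)
  · obtain ⟨l, hl, h⟩ := Metric.isOpen_iff.1 hU x hx
    refine ⟨_, basicNhds_singleton (Set.mem_singleton _) hl x, ?_⟩
    rwa [setOf_sub_mem_smul_unitBall hl]
  · rintro _ rfl
    simp
  · rintro _ rfl x l hl
    rw [setOf_sub_mem_smul_unitBall hl]
    exact Metric.isOpen_ball

theorem isLCSFamily_unitBall [TopologicalSpace.SeparableSpace N] :
    IsLCSFamily {Metric.ball (0 : N) 1} := by
  refine isLCSFamily_of_seminorms ?_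
  rintro _ rfl
  refine ⟨⟨normSeminorm ℝ N, ?_⟩, ?_⟩
  · ext x
    simp
  · rw [lcTopology_unitBall]
    infer_instance

theorem lcSigmaAlgebra_unitBall [TopologicalSpace.SeparableSpace N] :
    lcSigmaAlgebra {Metric.ball (0 : N) 1} = borel N := by
  refine le_antisymm (MeasurableSpace.generateFrom_le fun V hV => ?_)
    (MeasurableSpace.generateFrom_le fun U hU => ?_)
  · obtain ⟨x, r, C, l, hC, hl, rfl⟩ := Set.mem_iUnion.1 hV
    refine MeasurableSpace.measurableSet_generateFrom ?_
    rw [vadd_iInter_smul_eq]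
    refine isOpen_iInter_of_finite fun i => ?_
    rw [Set.mem_singleton_iff.1 (hC i), setOf_sub_mem_smul_unitBall (hl i)]
    exact Metric.isOpen_ball
  · let _ : MeasurableSpace N := lcSigmaAlgebra {Metric.ball (0 : N) 1}
    have := isLCSFamily_unitBall.measurableAdd₂ (E := N) rfl
    have hp : AreUnitBalls {Metric.ball (0 : N) 1} fun _ => normSeminorm ℝ N := by
      rintro _ rfl y
      simp
    refine (hp.separableSeminorm isLCSFamily_unitBall lcTopology_unitBall.symm rfl
      rfl).measurableSet fun x hx => ?_
    obtain ⟨l, hl, h⟩ := Metric.isOpen_iff.1 hU x hx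
    exact ⟨l, hl, fun y hy => h (mem_ball_iff_norm.2 hy)⟩

end NormedSpaces

/-! ### Weak topologies and cylinder σ-algebras -/

section WeakTopologies

variable {E Y : Type*} [AddCommGroup E] [Module ℝ E] [AddCommGroup Y] [Module ℝ Y]
  (B : E →ₗ[ℝ] Y →ₗ[ℝ] ℝ)

theorem setOf_sub_mem_smul_slab (y : Y) {l : ℝ} (hl : 0 < l) (x : E) :
    {z | z - x ∈ l • {x : E | |B x y| < 1}} = (fun z => B z y) ⁻¹' Metric.ball (B x y) l := by
  have hp : ∀ z, ((normSeminorm ℝ ℝ).comp (B.flip y)) z < 1 ↔ z ∈ {x : E | |B x y| < 1} :=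
    fun z => Iff.rfl
  ext z
  rw [Set.mem_ofPred_eq, mem_vadd_smul_iff_seminorm hp hl]
  simp [Real.dist_eq]

/-- The topology of one slab is coarser than the one pulled back from the real line by one
functional, which is second countable. -/
theorem isLCSFamily_weak : IsLCSFamily (Set.range fun y : Y => {x : E | |B x y| < 1}) := by
  refine isLCSFamily_of_seminorms ?_
  rintro _ ⟨y, rfl⟩
  refine ⟨⟨(normSeminorm ℝ ℝ).comp (B.flip y), rfl⟩, ?_⟩
  let t : TopologicalSpace E := TopologicalSpace.induced (fun x => B x y) inferInstance
  have hle : t ≤ lcTopology {{x : E | |B x y| < 1}} := by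
    refine le_lcTopology ?_ ?_
    · rintro _ rfl
      simp
    · rintro _ rfl x l hl
      rw [setOf_sub_mem_smul_slab B y hl]
      exact isOpen_induced Metric.isOpen_ball
  have : @SecondCountableTopology E t := TopologicalSpace.secondCountableTopology_induced _ _ _
  have hs : @TopologicalSpace.SeparableSpace E t := inferInstance
  have hid : @Continuous E E t (lcTopology {{x : E | |B x y| < 1}}) id := continuous_id_iff_le.2 hle
  exact @DenseRange.separableSpace E E t hs (lcTopology {{x : E | |B x y| < 1}}) id
    (@Function.Surjective.denseRange E (lcTopology _) E id Function.surjective_id) hid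

theorem lcTopology_weak : lcTopology (Set.range fun y : Y => {x : E | |B x y| < 1}) =
    ⨅ y : Y, TopologicalSpace.induced (fun x => B x y) inferInstance := by
  refine le_antisymm (le_iInf fun y => ?_) (le_lcTopology ?_ ?_)
  · rintro _ ⟨W, hW, rfl⟩ x hx
    obtain ⟨l, hl, h⟩ := Metric.isOpen_iff.1 hW _ hx
    refine ⟨_, basicNhds_singleton (Set.mem_range_self y) hl x, ?_⟩
    rw [setOf_sub_mem_smul_slab B y hl]
    exact Set.preimage_mono h
  · rintro _ ⟨y, rfl⟩
    simp
  · rintro _ ⟨y, rfl⟩ x l hl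
    refine (iInf_le (fun y : Y => TopologicalSpace.induced (fun x => B x y) inferInstance) y) _ ?_
    rw [setOf_sub_mem_smul_slab B y hl]
    exact ⟨_, Metric.isOpen_ball, rfl⟩

theorem lcSigmaAlgebra_weak : lcSigmaAlgebra (Set.range fun y : Y => {x : E | |B x y| < 1}) =
    ⨆ y : Y, MeasurableSpace.comap (fun x => B x y) (borel ℝ) := by
  refine le_antisymm (MeasurableSpace.generateFrom_le fun V hV => ?_) (iSup_le fun y => ?_)
  · obtain ⟨x, r, C, l, hC, hl, rfl⟩ := Set.mem_iUnion.1 hV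
    rw [vadd_iInter_smul_eq]
    refine MeasurableSet.iInter fun i => ?_
    obtain ⟨y, hy⟩ := hC i
    refine (le_iSup (fun y : Y => MeasurableSpace.comap (fun x => B x y) (borel ℝ)) y) _ ?_
    rw [← hy, setOf_sub_mem_smul_slab B y (hl i)]
    exact ⟨_, MeasurableSpace.measurableSet_generateFrom (s := {s | IsOpen s})
      (Metric.isOpen_ball (x := B x y) (ε := l i)), rfl⟩
  · let ℱ : MeasurableSpace E := lcSigmaAlgebra (Set.range fun y : Y => {x : E | |B x y| < 1})
    let τ : TopologicalSpace E := lcTopology (Set.range fun y : Y => {x : E | |B x y| < 1})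
    have h := isLCSFamily_weak B
    have := h.measurableAdd₂ rfl
    obtain ⟨p, hp⟩ := h.exists_areUnitBalls
    have hy := Set.mem_range_self (f := fun y : Y => {x : E | |B x y| < 1}) y
    obtain ⟨M, hM, hle⟩ := LinearMap.exists_le_mul_seminorm (p {x : E | |B x y| < 1}) (B.flip y)
      one_pos (C := 1) fun z hz => (le_abs_self _).trans ((hp _ hy z).1 hz).le
    have hm := (hp.separableSeminorm h rfl rfl hy).measurable_linearMap hM hle
    rw [← BorelSpace.measurable_eq (α := ℝ)]
    exact hm.comap_le

end WeakTopologies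

/-! ### Empirical measures in the `τ`-topology -/

section EmpiricalMeasures

variable {S : Type*} [MeasurableSpace S]

/-- The vector space of the bounded measurable real functions on `S`. -/
def boundedMeasurableSubmodule (S : Type*) [MeasurableSpace S] : Submodule ℝ (S → ℝ) where
  carrier := {f | Measurable f ∧ ∃ M : ℝ, ∀ a, |f a| ≤ M}
  zero_mem' := ⟨measurable_zero, 0, fun a => by simp⟩
  add_mem' := by
    rintro f g ⟨hf, M, hM⟩ ⟨hg, M', hM'⟩
    exact ⟨hf.add hg, M + M', fun a => (abs_add_le _ _).trans (add_le_add (hM a) (hM' a))⟩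
  smul_mem' := by
    rintro c f ⟨hf, M, hM⟩
    refine ⟨hf.const_smul c, |c| * M, fun a => ?_⟩
    rw [Pi.smul_apply, smul_eq_mul, abs_mul]
    gcongr
    exact hM a

/-- This makes bounded measurable functions integrable, without which the integral would not be
bilinear. -/
instance isFiniteMeasure_variation_signedMeasure (ν : SignedMeasure S) :
    IsFiniteMeasure ν.variation := by
  rw [← SignedMeasure.totalVariation_eq_variation, SignedMeasure.totalVariation]
  infer_instance

theorem integrable_variation_of_bounded (ν : SignedMeasure S)
    (f : boundedMeasurableSubmodule S) : Integrable (f : S → ℝ) ν.variation := by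
  obtain ⟨hf, M, hM⟩ := f.2
  exact Integrable.of_bound hf.aestronglyMeasurable M (ae_of_all _ hM)

/-- The integration pairing between finite signed measures and bounded measurable functions. -/
noncomputable def integralPairing (S : Type*) [MeasurableSpace S] :
    SignedMeasure S →ₗ[ℝ] boundedMeasurableSubmodule S →ₗ[ℝ] ℝ :=
  LinearMap.mk₂ ℝ (fun ν f => ∫ᵛ a, (f : S → ℝ) a ∂•ν)
    (fun ν ν' f => VectorMeasure.integral_add_vectorMeasure
      (integrable_variation_of_bounded ν f) (integrable_variation_of_bounded ν' f))
    (fun c _ _ => VectorMeasure.integral_smul_vectorMeasure _ c)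
    (fun ν f g => VectorMeasure.integral_add
      (integrable_variation_of_bounded ν f) (integrable_variation_of_bounded ν g))
    (fun c ν f => VectorMeasure.integral_smul (f : S → ℝ) ν _ c)

theorem integralPairing_apply (ν : SignedMeasure S) (f : boundedMeasurableSubmodule S) :
    integralPairing S ν f = ∫ᵛ a, (f : S → ℝ) a ∂•ν := rfl

/-- The bounded measurable functions, as the elements of a vector space. -/
def boundedMeasurableEquiv (S : Type*) [MeasurableSpace S] :
    BoundedMeasurable S ≃ boundedMeasurableSubmodule S where
  toFun f := ⟨f.1, f.2⟩
  invFun f := ⟨f.1, f.2⟩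

theorem tauTopology_eq_lcTopology : tauTopology S = lcTopology (Set.range
    fun f : boundedMeasurableSubmodule S =>
      {ν : SignedMeasure S | |integralPairing S ν f| < 1}) := by
  rw [lcTopology_weak, tauTopology]
  refine (boundedMeasurableEquiv S).iInf_congr fun f => ?_
  simp only [integralPairing_apply]
  rfl

theorem cylinderSigmaAlgebra_eq_lcSigmaAlgebra : cylinderSigmaAlgebra S = lcSigmaAlgebra (Set.range
    fun f : boundedMeasurableSubmodule S =>
      {ν : SignedMeasure S | |integralPairing S ν f| < 1}) := by
  rw [lcSigmaAlgebra_weak, cylinderSigmaAlgebra]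
  refine (boundedMeasurableEquiv S).iSup_congr fun f => ?_
  simp only [integralPairing_apply]
  rfl

theorem integral_toSignedMeasure_dirac {f : S → ℝ} (hf : Measurable f) (a : S) :
    ∫ᵛ b, f b ∂•(Measure.dirac a).toSignedMeasure = f a := by
  have : (Measure.dirac a).toSignedMeasure = VectorMeasure.dirac a (1 : ℝ) := by
    ext s hs
    by_cases ha : a ∈ s <;>
      simp [Measure.toSignedMeasure_apply_measurable hs, measureReal_def, hs, ha]
  rw [this, VectorMeasure.integral_dirac' hf.stronglyMeasurable]
  simp

/-- Composing the integral of `f` with the Dirac map gives back `f`, which is measurable. -/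
theorem measurable_toSignedMeasure_dirac [ℱ : MeasurableSpace (SignedMeasure S)]
    (hℱ : ℱ = cylinderSigmaAlgebra S) :
    Measurable fun a : S => (Measure.dirac a).toSignedMeasure := by
  rw [measurable_iff_comap_le, hℱ, cylinderSigmaAlgebra, MeasurableSpace.comap_iSup]
  refine iSup_le fun f => ?_
  rw [MeasurableSpace.comap_comp, ← BorelSpace.measurable_eq (α := ℝ)]
  have : ((fun ν : SignedMeasure S => ∫ᵛ a, f.1 a ∂•ν) ∘
      fun a : S => (Measure.dirac a).toSignedMeasure) = f.1 :=
    funext fun a => integral_toSignedMeasure_dirac f.2.1 a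
  rw [this]
  exact f.2.1.comap_le

/-- Cramér's theorem for empirical measures in the `τ`-topology. -/
theorem cramerConclusion_dirac {Ω : Type*} [MeasurableSpace Ω]
    {τ : TopologicalSpace (SignedMeasure S)} {ℱ : MeasurableSpace (SignedMeasure S)}
    (hτ : τ = tauTopology S) (hℱ : ℱ = cylinderSigmaAlgebra S)
    {P : Measure Ω} [IsProbabilityMeasure P] {Y : ℕ → Ω → S} (hY : ∀ i, Measurable (Y i))
    (hind : iIndepFun Y P) (hid : ∀ i, IdentDistrib (Y i) (Y 0) P P) :
    CramerConclusion P (fun i ω => (Measure.dirac (Y i ω)).toSignedMeasure) := by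
  have hm := measurable_toSignedMeasure_dirac hℱ
  exact (isLCSFamily_weak (integralPairing S)).cramerConclusion
    (hτ.trans tauTopology_eq_lcTopology) (hℱ.trans cylinderSigmaAlgebra_eq_lcSigmaAlgebra)
    (fun i => hm.comp (hY i)) (hind.comp (fun _ a => (Measure.dirac a).toSignedMeasure) fun _ => hm)
    fun i => (hid i).comp hm

end EmpiricalMeasures

theorem mainTheorem5 :
    -- The weak large deviation principle with entropy `s = -p^*` on `(E, τ(𝒞), ℱ(𝒞))`.
    (∀ {E Ω : Type*} [AddCommGroup E] [Module ℝ E] [τ : TopologicalSpace E]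
      [ℱ : MeasurableSpace E] [MeasurableSpace Ω] (𝒞 : Set (Set E)) (_ : IsLCSFamily 𝒞)
      (_ : τ = lcTopology 𝒞) (_ : ℱ = lcSigmaAlgebra 𝒞)
      (P : Measure Ω) [IsProbabilityMeasure P] (X : ℕ → Ω → E)
      (_ : ∀ i, Measurable (X i)) (_ : iIndepFun X P)
      (_ : ∀ i, IdentDistrib (X i) (X 0) P P), CramerConclusion P X) ∧
    -- Separable normed spaces with the norm topology and the Borel σ-algebra are covered.
    (∀ {N : Type*} [NormedAddCommGroup N] [NormedSpace ℝ N] [TopologicalSpace.SeparableSpace N],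
      IsLCSFamily {Metric.ball (0 : N) 1} ∧
      lcTopology {Metric.ball (0 : N) 1} = (inferInstance : TopologicalSpace N) ∧
      lcSigmaAlgebra {Metric.ball (0 : N) 1} = borel N) ∧
    -- Weak topologies with the cylinder σ-algebra are covered.
    (∀ {E Y : Type*} [AddCommGroup E] [Module ℝ E] [AddCommGroup Y] [Module ℝ Y]
      (B : E →ₗ[ℝ] Y →ₗ[ℝ] ℝ),
      IsLCSFamily (Set.range fun y : Y => {x : E | |B x y| < 1}) ∧
      lcTopology (Set.range fun y : Y => {x : E | |B x y| < 1}) =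
        ⨅ y : Y, TopologicalSpace.induced (fun x => B x y) inferInstance ∧
      lcSigmaAlgebra (Set.range fun y : Y => {x : E | |B x y| < 1}) =
        ⨆ y : Y, MeasurableSpace.comap (fun x => B x y) (borel ℝ)) ∧
    -- Empirical measures of i.i.d. points, in the `τ`-topology, are covered.
    (∀ {S Ω : Type*} [MeasurableSpace S] [MeasurableSpace Ω]
      [τ : TopologicalSpace (SignedMeasure S)] [ℱ : MeasurableSpace (SignedMeasure S)]
      (_ : τ = tauTopology S) (_ : ℱ = cylinderSigmaAlgebra S)
      (P : Measure Ω) [IsProbabilityMeasure P] (Y : ℕ → Ω → S)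
      (_ : ∀ i, Measurable (Y i)) (_ : iIndepFun Y P)
      (_ : ∀ i, IdentDistrib (Y i) (Y 0) P P),
      CramerConclusion P (fun i ω => (Measure.dirac (Y i ω)).toSignedMeasure)) := by

  refine ⟨?_, ?_, ?_, ?_⟩
  · intro E Ω _ _ τ ℱ _ 𝒞 h hτ hℱ P _ X hX hind hid
    exact h.cramerConclusion hτ hℱ hX hind hid
  · intro N _ _ _
    exact ⟨isLCSFamily_unitBall, lcTopology_unitBall, lcSigmaAlgebra_unitBall⟩
  · intro E Y _ _ _ _ B
    exact ⟨isLCSFamily_weak B, lcTopology_weak B, lcSigmaAlgebra_weak B⟩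
  · intro S Ω _ _ τ ℱ hτ hℱ P _ Y hY hind hid
    exact cramerConclusion_dirac hτ hℱ hY hind hid
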